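/- Let $\sigma_0=\mathrm{id}$ and let $\sigma_1,\sigma_2,\sigma_3$ be the Pauli matrices, and put $\mathfrak k=\mathrm{span}_{\mathbb R}\{\tfrac i2\sigma_0\otimes\sigma_j,\ \tfrac i2\sigma_j\otimes\sigma_0 : 1\le j\le 3\}$, $\mathfrak p=\mathrm{span}_{\mathbb R}\{\tfrac i2\sigma_j\otimes\sigma_k : 1\le j,k\le 3\}$, $\mathfrak a=\mathrm{span}_{\mathbb R}\{\tfrac i2\sigma_j\otimes\sigma_j : 1\le j\le 3\}$, so that $\mathfrak{su}(4)=\mathfrak k\oplus\mathfrak p$ and $\mathfrak a\subset\mathfrak p$. Let $K=\exp(\mathfrak k)$ be the subgroup of $\mathrm{SU}(4)$ generated by $\mathfrak k$, and let $\mathrm{Ad}(g)(X)=g^{-1}Xg$. The Weyl group is the factor group $N_K(\mathfrak a)/C_K(\mathfrak a)$ of the normalizer $N_K(\mathfrak a)=\{k\in K: \mathrm{Ad}(k)(\mathfrak a)\subset\mathfrak a\}$ by the centralizer $C_K(\mathfrak a)=\{k\in K:\mathrm{Ad}(k)(x)=x\text{ for all }x\in\mathfrak a\}$; it operates on $\mathfrak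 a$ by $\mathrm{Ad}$. The Weyl orbit $\mathcal W(p)$ of $p\in\mathfrak p$ is the orbit under the Weyl group of any $a\in\mathfrak a\cap\mathrm{Ad}(K)(p)$ (it does not depend on $a$). A local unitary operator is an operator $u\otimes v$ with $u,v\in\mathrm{SU}(2)$. A Hamilton operator $H$ on two qubits is called non-local if it has no local terms, i.e. if $iH\in\mathfrak p$. A two-qubit system with Hamilton operator $H$ and local unitary operators available simulates $H'$ infinitesimally in time $t$ if there are $m\in\mathbb N\cup\{0,\infty\}$, local unitary operators $U_0$ and $U_j$, and times $t_j\ge 0$ ($j\in\mathbb N$, $1\le j\le m$) with $t=\sum_{j=1}^m t_j$, $\prod_{j=0}^m U_j=\mathrm{id}$ and $$\lim_{s\to0,\ s>0}\frac{d}{ds}e^{-isH'}=\lim_{s\to0,\ s>0}\frac{d}{ds}\Bigl(\Bigl[\prod_{j=1}^m U_j e^{-isHt_j}\Bigr]U_0\Bigr),$$ where products are ordered with larger indices to the left, and for $m=\infty$ are limits of the partial products. **Theorem.** Let $H$ and $H'$ be non-local Hamilton operators on two qubits, let $t>0$, and let $a'=\mathrm{Ad}(L')(iH')\in\mathfrak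 a$ for some local unitary operator $L'$. The two-qubit system with Hamilton operator $H$ and local unitary operators available simulates $H'$ infinitesimally in time $t$ if and only if $a'/t$ lies in the convex hull of the Weyl orbit $\mathcal W(iH)$. This condition is independent of the choice of $a'$: if also $a''=\mathrm{Ad}(L'')(iH')\in\mathfrak a$ for some local unitary operator $L''$, then $a'/t$ lies in this convex hull if and only if $a''/t$ does. -/

import Mathlib

open Complex Filter Topology
open scoped Matrix Kronecker

noncomputable section

namespace TwoQubit

/-- Operators on the two-qubit space `ℂ² ⊗ ℂ²`, as complex `4 × 4` matrices. -/
abbrev Op : Type := Matrix (Fin 2 × Fin 2) (Fin 2 × Fin 2) ℂ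

/-- The group `SU(4)`. -/
abbrev SU4 : Type := ↥(Matrix.specialUnitaryGroup (Fin 2 × Fin 2) ℂ)

/-! ### The Lie algebra data `𝔨`, `𝔭`, `𝔞` -/

/-- The identity matrix and the three Pauli matrices `σ₀, σ₁, σ₂, σ₃`. -/
def pauli : Fin 4 → Matrix (Fin 2) (Fin 2) ℂ :=
  ![1, !![0, 1; 1, 0], !![0, -I; I, 0], !![1, 0; 0, -1]]

/-- The matrix `(i/2) σ_j ⊗ σ_k`. -/
def pauliX (j k : Fin 4) : Op := (I / 2) • (pauli j ⊗ₖ pauli k)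

/-- `𝔨`: the real span of the `(i/2) σ₀ ⊗ σ_j` and `(i/2) σ_j ⊗ σ₀` with `j ≠ 0`. -/
def kSpace : Submodule ℝ Op :=
  Submodule.span ℝ {X | ∃ j : Fin 4, j ≠ 0 ∧ (X = pauliX 0 j ∨ X = pauliX j 0)}

/-- `𝔭`: the real span of the `(i/2) σ_j ⊗ σ_k` with `j, k ≠ 0`. -/
def pSpace : Submodule ℝ Op :=
  Submodule.span ℝ {X | ∃ j k : Fin 4, j ≠ 0 ∧ k ≠ 0 ∧ X = pauliX j k}

/-- `𝔞`: the real span of the `(i/2) σ_j ⊗ σ_j` with `j ≠ 0`. -/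
def aSpace : Submodule ℝ Op :=
  Submodule.span ℝ {X | ∃ j : Fin 4, j ≠ 0 ∧ X = pauliX j j}

/-- The subgroup `K = exp(𝔨)` of `SU(4)` generated by `𝔨`. -/
def groupK : Subgroup SU4 :=
  Subgroup.closure {g | ∃ X ∈ kSpace, (g : Op) = NormedSpace.exp X}

/-- `Ad(g)` is the map `X ↦ g⁻¹ X g`. -/
def Ad (g : SU4) : Op →ₗ[ℝ] Op where
  toFun X := ((g⁻¹ : SU4) : Op) * X * (g : Op)
  map_add' X Y := by rw [mul_add, add_mul]
  map_smul' r X := by simp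

theorem Ad_apply (g : SU4) (X : Op) : Ad g X = ((g⁻¹ : SU4) : Op) * X * (g : Op) := rfl

@[simp] theorem Ad_one (X : Op) : Ad 1 X = X := by simp [Ad_apply]

theorem Ad_mul (g h : SU4) (X : Op) : Ad (g * h) X = Ad h (Ad g X) := by
  simp only [Ad_apply, mul_inv_rev, Submonoid.coe_mul, mul_assoc]

@[simp] theorem Ad_inv_Ad (g : SU4) (X : Op) : Ad g⁻¹ (Ad g X) = X := by
  rw [← Ad_mul, mul_inv_cancel, Ad_one]

@[simp] theorem Ad_Ad_inv (g : SU4) (X : Op) : Ad g (Ad g⁻¹ X) = X := by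
  rw [← Ad_mul, inv_mul_cancel, Ad_one]

/-! ### The Weyl group and Weyl orbits -/

theorem Ad_inv_mem_aSpace {g : SU4} (hg : ∀ X ∈ aSpace, Ad g X ∈ aSpace) {X : Op}
    (hX : X ∈ aSpace) : Ad g⁻¹ X ∈ aSpace := by
  have hinj : Function.Injective ((Ad g).restrict hg) := by
    intro Y Z h
    have h2 := congrArg (fun W : aSpace => Ad g⁻¹ (W : Op)) h
    simpa using h2
  obtain ⟨Y, hY⟩ := LinearMap.injective_iff_surjective.mp hinj ⟨X, hX⟩
  have h3 : Ad g (Y : Op) = X := congrArg Subtype.val hY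
  rw [← h3, Ad_inv_Ad]
  exact Y.2

/-- The normalizer `N_K(𝔞) = {k ∈ K | Ad(k)(𝔞) ⊆ 𝔞}`. -/
def normalizerK : Subgroup SU4 where
  carrier := {g | g ∈ groupK ∧ ∀ X ∈ aSpace, Ad g X ∈ aSpace}
  mul_mem' := by
    rintro g h ⟨hg, hg'⟩ ⟨hh, hh'⟩
    exact ⟨mul_mem hg hh, fun X hX => by rw [Ad_mul]; exact hh' _ (hg' _ hX)⟩
  one_mem' := ⟨one_mem _, fun X hX => by rwa [Ad_one]⟩
  inv_mem' := by
    rintro g ⟨hg, hg'⟩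
    exact ⟨inv_mem hg, fun X hX => Ad_inv_mem_aSpace hg' hX⟩

/-- The centralizer `C_K(𝔞) = {k ∈ K | Ad(k)(X) = X for all X ∈ 𝔞}`. -/
def centralizerK : Subgroup SU4 where
  carrier := {g | g ∈ groupK ∧ ∀ X ∈ aSpace, Ad g X = X}
  mul_mem' := by
    rintro g h ⟨hg, hg'⟩ ⟨hh, hh'⟩
    exact ⟨mul_mem hg hh, fun X hX => by rw [Ad_mul, hg' X hX, hh' X hX]⟩
  one_mem' := ⟨one_mem _, fun X _ => Ad_one X⟩
  inv_mem' := by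
    rintro g ⟨hg, hg'⟩
    refine ⟨inv_mem hg, fun X hX => ?_⟩
    conv_lhs => rw [← hg' X hX]
    rw [Ad_inv_Ad]

instance centralizerK_normal : (centralizerK.subgroupOf normalizerK).Normal where
  conj_mem := by
    rintro ⟨c, _⟩ hc ⟨g, hg⟩
    rw [Subgroup.mem_subgroupOf] at hc ⊢
    refine ⟨mul_mem (mul_mem hg.1 hc.1) (inv_mem hg.1), fun X hX => ?_⟩
    change Ad (g * c * g⁻¹) X = X
    rw [Ad_mul, Ad_mul]
    rw [show Ad c (Ad g X) = Ad g X from hc.2 _ (hg.2 X hX), Ad_inv_Ad]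

/-- The Weyl group: the factor group `N_K(𝔞) / C_K(𝔞)`. -/
abbrev WeylGroup : Type := ↥normalizerK ⧸ centralizerK.subgroupOf normalizerK

/-- The operation of the Weyl group on `𝔞` by `Ad`. -/
def weylAct (w : WeylGroup) (a : aSpace) : aSpace :=
  Quotient.liftOn' w
    (fun g : normalizerK => (⟨Ad (g : SU4) (a : Op), g.2.2 a a.2⟩ : aSpace))
    (by
      intro g h hgh
      rw [QuotientGroup.leftRel_apply, Subgroup.mem_subgroupOf] at hgh
      apply Subtype.ext
      change Ad (g : SU4) (a : Op) = Ad (h : SU4) (a : Op)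
      have h1 := hgh.2 (Ad (g : SU4) (a : Op)) (g.2.2 a a.2)
      rw [← Ad_mul] at h1
      rw [← h1]
      simp)

theorem weylAct_mk (g : normalizerK) (a : aSpace) :
    (weylAct (QuotientGroup.mk g) a : Op) = Ad (g : SU4) (a : Op) := rfl

/-- The Weyl orbit `{Ad(w)(a) | w in the Weyl group}` of `a ∈ 𝔞`. -/
def weylOrbitA (a : aSpace) : Set Op := {x | ∃ w : WeylGroup, x = (weylAct w a : Op)}

/-- The Weyl orbit of `p ∈ 𝔭`: the Weyl orbit of any `a ∈ Ad(K)(p) ∩ 𝔞`. All such `a` have the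
same Weyl orbit, so that the union over them is this orbit. -/
def weylOrbit (p : Op) : Set Op :=
  {x | ∃ a : aSpace, (∃ k ∈ groupK, (a : Op) = Ad k p) ∧ x ∈ weylOrbitA a}

/-! ### Infinitesimal Hamiltonian simulation -/

/-- `H` is a non-local Hamilton operator, i.e. one without local terms: `i H ∈ 𝔭`. -/
def IsNonlocalHamiltonian (H : Op) : Prop := I • H ∈ pSpace

/-- Local unitary operators `u ⊗ v` with `u, v ∈ SU(2)`. -/
def IsLocalUnitary (g : SU4) : Prop :=
  ∃ u v : Matrix.specialUnitaryGroup (Fin 2) ℂ,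
    (g : Op) = (u : Matrix (Fin 2) (Fin 2) ℂ) ⊗ₖ (v : Matrix (Fin 2) (Fin 2) ℂ)

/-- The ordered product `V n * V (n - 1) * ⋯ * V 1`. -/
def orderedProd (V : ℕ → Op) : ℕ → Op
  | 0 => 1
  | n + 1 => V (n + 1) * orderedProd V n

/-- `P` is the ordered product `∏_{j=1}^m V j` (factors with larger index to the left) with
`m ∈ ℕ ∪ {∞}`; for `m = ∞` it is the limit of the partial products. -/
def IsOrderedProd (V : ℕ → Op) (m : ℕ∞) (P : Op) : Prop :=
  match m with
  | some n => P = orderedProd V n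
  | none => Tendsto (orderedProd V) atTop (𝓝 P)

/-- `t = ∑_{j=1}^m τ j` with `m ∈ ℕ ∪ {∞}` (a convergent series if `m = ∞`). -/
def IsTotalTime (τ : ℕ → ℝ) (m : ℕ∞) (t : ℝ) : Prop :=
  match m with
  | some n => t = ∑ j ∈ Finset.Icc 1 n, τ j
  | none => HasSum (fun j : ℕ => τ (j + 1)) t

/-- A two-qubit system with Hamilton operator `H` and local unitary operators available simulates
the Hamilton operator `H'` infinitesimally in time `t`: there are `m ∈ ℕ ∪ {∞}`, local unitary
operators `U j` and times `τ j ≥ 0` with total time `t` such that `∏_{j=0}^m U j = 1` and such that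
the evolution `F s = (∏_{j=1}^m U j * exp (-i s H τ j)) * U 0` of the program satisfies
`lim_{s → 0, s > 0} d/ds exp (-i s H') = lim_{s → 0, s > 0} d/ds F s`, where the product, the
derivative and both limits exist. -/
def SimulatesInfinitesimally (H H' : Op) (t : ℝ) : Prop :=
  ∃ (m : ℕ∞) (U : ℕ → SU4) (τ : ℕ → ℝ),
    (∀ j, IsLocalUnitary (U j)) ∧
    (∀ j, 0 ≤ τ j) ∧
    IsTotalTime τ m t ∧
    (∃ P : Op, IsOrderedProd (fun j => (U j : Op)) m P ∧ P * (U 0 : Op) = 1) ∧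
    ∃ Q : ℝ → Op,
      (∀ s : ℝ, IsOrderedProd
        (fun j => (U j : Op) * NormedSpace.exp ((-I * (s : ℂ) * (τ j : ℂ)) • H)) m (Q s)) ∧
      (∀ᶠ s : ℝ in 𝓝[>] 0, DifferentiableAt ℝ (fun r : ℝ => Q r * (U 0 : Op)) s) ∧
      ∃ D : Op,
        Tendsto (deriv fun s : ℝ => NormedSpace.exp ((-I * (s : ℂ)) • H')) (𝓝[>] 0) (𝓝 D) ∧
        Tendsto (deriv fun s : ℝ => Q s * (U 0 : Op)) (𝓝[>] 0) (𝓝 D)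

end TwoQubit

end

open Complex Filter Topology
open scoped Matrix Kronecker

noncomputable section

namespace TwoQubit

/-! ### Local unitary operators -/

/-! Write W_j = U_j ⋯ U_0 for the partial products of a program. Moving all local unitaries to the
left turns the evolution into W_m times a product of exponentials of the Ad(W_j)(-isτ_{j+1}H). The
right derivative at s = 0 is therefore the sum of the τ_{j+1} Ad(W_j)(-iH). The error bound
(`ExpApprox.mul`, `expApprox_program`) depends only on the total time, so it survives the limit m =
∞. Simulation in time t thus makes iH' a convergent sum of terms c_j Ad(V_j)(iH) with c_j ≥ 0 and ∑
c_j = t (`exists_hasSum_of_simulates`). Conversely, any finite sum of this form with local V_j comes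
from a program, by telescoping (`simulates_of_sum`).

It remains to compare such sums with the convex hull of the Weyl orbit. The orbit lies in Ad(K)(iH),
so points of the hull are finite sums of the required kind (`exists_sum_of_mem_convexHull`).

The other inclusion is a convexity theorem of Schur–Horn type. Elements of 𝔞 are diagonal in the
Bell basis with eigenvalues i d_0, …, i d_3 of sum 0 (`mem_aSpace_iff`). Conjugating by a unitary
and keeping the Bell diagonal replaces d by S d, where S is doubly stochastic
(`bellCoeff_Ad_bellDiag`). Convergent convex combinations of such S are again doubly stochastic
(`exists_doublyStochastic_hasSum`), and by Birkhoff's theorem they are convex combinations of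
permutations. Every permutation of the Bell eigenvalues is realized in K
(`exists_Ad_bellDiag_perm`), so S d lies in the hull of the orbit. The initial diagonalization of iH
under K is a compactness argument (`exists_Ad_mem_aSpace`). -/

/-- The group `SU(2)`. -/
abbrev SU2 : Type := ↥(Matrix.specialUnitaryGroup (Fin 2) ℂ)

/-- The homomorphism `(u, v) ↦ u ⊗ v` from `SU(2) × SU(2)` to `SU(4)`. -/
def localHom : SU2 × SU2 →* SU4 where
  toFun p := ⟨(p.1 : Matrix (Fin 2) (Fin 2) ℂ) ⊗ₖ (p.2 : Matrix (Fin 2) (Fin 2) ℂ), by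
    have h1 := Matrix.mem_specialUnitaryGroup_iff.mp p.1.2
    have h2 := Matrix.mem_specialUnitaryGroup_iff.mp p.2.2
    rw [Matrix.mem_specialUnitaryGroup_iff]
    exact ⟨Matrix.kronecker_mem_unitary h1.1 h2.1, by
      rw [Matrix.det_kronecker, h1.2, h2.2]; simp⟩⟩
  map_one' := by
    apply Subtype.ext
    simp
  map_mul' p q := by
    apply Subtype.ext
    simp [Matrix.mul_kronecker_mul]

theorem coe_localHom (u v : SU2) : (localHom (u, v) : Op) =
    (u : Matrix (Fin 2) (Fin 2) ℂ) ⊗ₖ (v : Matrix (Fin 2) (Fin 2) ℂ) := rfl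

theorem isLocalUnitary_iff {g : SU4} : IsLocalUnitary g ↔ g ∈ localHom.range := by
  constructor
  · rintro ⟨u, v, h⟩
    exact ⟨(u, v), Subtype.ext h.symm⟩
  · rintro ⟨⟨u, v⟩, rfl⟩
    exact ⟨u, v, rfl⟩

theorem coe_inv_SU4 (g : SU4) : ((g⁻¹ : SU4) : Op) = star (g : Op) := rfl

theorem coe_inv_mul_self (g : SU4) : ((g⁻¹ : SU4) : Op) * (g : Op) = 1 := by
  rw [← Submonoid.coe_mul, inv_mul_cancel]; rfl

theorem coe_mul_inv_self (g : SU4) : (g : Op) * ((g⁻¹ : SU4) : Op) = 1 := by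
  rw [← Submonoid.coe_mul, mul_inv_cancel]; rfl

/-! ### Exponentials of complex structures -/

/-- Since J² = -1, there is a continuous algebra homomorphism from ℂ with i ↦ J; it transports
Euler's formula. -/
theorem exp_real_smul_of_mul_self_eq_neg_one {n : Type*} [Fintype n] [DecidableEq n]
    {J : Matrix n n ℂ} (hJ : J * J = -1) (θ : ℝ) :
    NormedSpace.exp (θ • J) = Real.cos θ • (1 : Matrix n n ℂ) + Real.sin θ • J := by
  set f : ℂ →ₐ[ℝ] Matrix n n ℂ := Complex.lift ⟨J, hJ⟩ with hf
  have hfz : ∀ z : ℂ, f z = z.re • (1 : Matrix n n ℂ) + z.im • J := by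
    intro z
    rw [hf, Complex.lift_apply, Complex.liftAux_apply, Algebra.algebraMap_eq_smul_one]
  have hcont : Continuous f := by
    have : (f : ℂ → Matrix n n ℂ) = fun z => z.re • (1 : Matrix n n ℂ) + z.im • J := funext hfz
    rw [this]
    fun_prop
  have h1 : f (θ * I) = θ • J := by
    rw [hfz]; simp
  have h2 : f (NormedSpace.exp (θ * I)) = NormedSpace.exp (f (θ * I)) := by
    open scoped Matrix.Norms.Operator in
    exact NormedSpace.map_exp (f : ℂ →+* Matrix n n ℂ) hcont (θ * I)
  rw [← h1, ← h2, ← Complex.exp_eq_exp_ℂ, hfz]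
  simp [Complex.exp_re, Complex.exp_im]

/-- The skew-Hermitian matrix `i (x σ₁ + y σ₂ + z σ₃)`. -/
def su2 (x y z : ℝ) : Matrix (Fin 2) (Fin 2) ℂ :=
  !![I * z, y + I * x; -y + I * x, -(I * z)]

theorem su2_mul_self (x y z : ℝ) :
    su2 x y z * su2 x y z = (-(x ^ 2 + y ^ 2 + z ^ 2)) • (1 : Matrix (Fin 2) (Fin 2) ℂ) := by
  ext i j
  fin_cases i <;> fin_cases j <;>
    simp [su2, Matrix.mul_apply, Fin.sum_univ_two] <;> ring_nf <;> simp <;> ring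

theorem smul_su2 (r x y z : ℝ) : r • su2 x y z = su2 (r * x) (r * y) (r * z) := by
  ext i j
  fin_cases i <;> fin_cases j <;> simp [su2] <;> ring

theorem smul_one_add_su2_mem {w x y z : ℝ} (h : w ^ 2 + x ^ 2 + y ^ 2 + z ^ 2 = 1) :
    w • (1 : Matrix (Fin 2) (Fin 2) ℂ) + su2 x y z ∈ Matrix.specialUnitaryGroup (Fin 2) ℂ := by
  have hc : (w : ℂ) ^ 2 + x ^ 2 + y ^ 2 + z ^ 2 = 1 := by exact_mod_cast h
  rw [Matrix.mem_specialUnitaryGroup_iff, Matrix.mem_unitaryGroup_iff]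
  constructor
  · ext i j
    fin_cases i <;> fin_cases j <;>
      simp [su2, Matrix.mul_apply, Fin.sum_univ_two, Matrix.star_apply] <;>
      ring_nf <;> simp <;> linear_combination hc
  · rw [Matrix.det_fin_two]
    simp [su2]
    ring_nf
    simp
    linear_combination hc

theorem exists_eq_smul_one_add_su2 (u : SU2) : ∃ w x y z : ℝ, w ^ 2 + x ^ 2 + y ^ 2 + z ^ 2 = 1 ∧
    (u : Matrix (Fin 2) (Fin 2) ℂ) = w • (1 : Matrix (Fin 2) (Fin 2) ℂ) + su2 x y z := by
  obtain ⟨u, hu⟩ := u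
  obtain ⟨hu1, hdet⟩ := Matrix.mem_specialUnitaryGroup_iff.mp hu
  have h1 := Matrix.mem_unitaryGroup_iff.mp hu1
  -- For determinant one the adjugate is the inverse, hence the adjoint; comparing entries gives the
  -- unit quaternion form.
  have hinv : star u = u.adjugate := by
    have : star u * (u * u.adjugate) = u.adjugate := by
      rw [← mul_assoc, Matrix.mem_unitaryGroup_iff'.mp hu1, one_mul]
    rwa [Matrix.mul_adjugate, hdet, one_smul, mul_one] at this
  have h00 := congrFun (congrFun hinv 0) 0
  have h01 := congrFun (congrFun hinv 0) 1
  rw [Matrix.adjugate_fin_two] at h00 h01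
  simp [Matrix.star_apply] at h00 h01
  have hd : u 0 0 * u 1 1 - u 0 1 * u 1 0 = 1 := by rw [← Matrix.det_fin_two, hdet]
  refine ⟨(u 0 0).re, (u 0 1).im, (u 0 1).re, (u 0 0).im, ?_, ?_⟩
  · have h10 : u 1 0 = -(starRingEnd ℂ) (u 0 1) := by
      rw [← neg_eq_iff_eq_neg.mpr h01.symm.symm]
      simp
    rw [← h00, h10] at hd
    have := congrArg Complex.re hd
    simp at this
    nlinarith
  · have h10 : u 1 0 = -(starRingEnd ℂ) (u 0 1) := by
      rw [← neg_eq_iff_eq_neg.mpr h01.symm.symm]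
      simp
    ext i j
    fin_cases i <;> fin_cases j
    · apply Complex.ext <;> simp [su2]
    · apply Complex.ext <;> simp [su2]
    · apply Complex.ext <;> simp [su2, h10]
    · apply Complex.ext <;> simp [su2, ← h00]

theorem exists_su2_polar (x y z : ℝ) : ∃ θ a b c : ℝ, a ^ 2 + b ^ 2 + c ^ 2 = 1 ∧
    θ ^ 2 = x ^ 2 + y ^ 2 + z ^ 2 ∧ su2 x y z = θ • su2 a b c := by
  set r := Real.sqrt (x ^ 2 + y ^ 2 + z ^ 2) with hr
  have hr2 : r ^ 2 = x ^ 2 + y ^ 2 + z ^ 2 := Real.sq_sqrt (by positivity)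
  by_cases h0 : r = 0
  -- For the zero vector the axis is arbitrary.
  · refine ⟨0, 1, 0, 0, by norm_num, by rw [← hr2, h0], ?_⟩
    rw [h0] at hr2
    have hx : x = 0 := by nlinarith [sq_nonneg x, sq_nonneg y, sq_nonneg z]
    have hy : y = 0 := by nlinarith [sq_nonneg x, sq_nonneg y, sq_nonneg z]
    have hz : z = 0 := by nlinarith [sq_nonneg x, sq_nonneg y, sq_nonneg z]
    rw [hx, hy, hz, smul_su2]
    simp
  · refine ⟨r, x / r, y / r, z / r, ?_, hr2, ?_⟩
    · field_simp
      exact hr2.symm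
    · rw [smul_su2]
      congr 1 <;> field_simp

theorem su2_mul_self_of_unit {a b c : ℝ} (h : a ^ 2 + b ^ 2 + c ^ 2 = 1) :
    su2 a b c * su2 a b c = -1 := by
  rw [su2_mul_self, h]; simp

theorem exp_su2_mem (x y z : ℝ) :
    NormedSpace.exp (su2 x y z) ∈ Matrix.specialUnitaryGroup (Fin 2) ℂ := by
  obtain ⟨θ, a, b, c, h, -, he⟩ := exists_su2_polar x y z
  rw [he, exp_real_smul_of_mul_self_eq_neg_one (su2_mul_self_of_unit h), smul_su2]
  apply smul_one_add_su2_mem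
  linear_combination Real.sin_sq_add_cos_sq θ + Real.sin θ ^ 2 * h

theorem exists_eq_exp_su2 (u : SU2) : ∃ x y z : ℝ,
    (u : Matrix (Fin 2) (Fin 2) ℂ) = NormedSpace.exp (su2 x y z) := by
  obtain ⟨w, x, y, z, h, hu⟩ := exists_eq_smul_one_add_su2 u
  obtain ⟨r, a, b, c, h1, hr, he⟩ := exists_su2_polar x y z
  obtain ⟨θ, hc, hs⟩ : ∃ θ : ℝ, w = Real.cos θ ∧ r = Real.sin θ := by
    have hn : ‖(⟨w, r⟩ : ℂ)‖ = 1 := by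
      rw [Complex.norm_eq_sqrt_sq_add_sq, Real.sqrt_eq_one]
      linarith
    have hne : (⟨w, r⟩ : ℂ) ≠ 0 := by
      rw [← norm_pos_iff, hn]; norm_num
    refine ⟨Complex.arg ⟨w, r⟩, ?_, ?_⟩
    · rw [Complex.cos_arg hne, hn]; simp
    · rw [Complex.sin_arg, hn]; simp
  refine ⟨θ * a, θ * b, θ * c, ?_⟩
  rw [← smul_su2, exp_real_smul_of_mul_self_eq_neg_one (su2_mul_self_of_unit h1), hu, he, hc, hs]

theorem exp_kronecker_one {m n : Type*} [Fintype m] [DecidableEq m] [Fintype n] [DecidableEq n]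
    (A : Matrix m m ℂ) :
    NormedSpace.exp (A ⊗ₖ (1 : Matrix n n ℂ)) = NormedSpace.exp A ⊗ₖ (1 : Matrix n n ℂ) := by
  let f : Matrix m m ℂ →+* Matrix (m × n) (m × n) ℂ :=
    { toFun := fun X => X ⊗ₖ 1
      map_one' := by simp
      map_mul' := fun X Y => by rw [← Matrix.mul_kronecker_mul, one_mul]
      map_zero' := by simp
      map_add' := fun X Y => Matrix.add_kronecker X Y 1 }
  have hf : Continuous f := by
    change Continuous fun X : Matrix m m ℂ => X ⊗ₖ (1 : Matrix n n ℂ)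
    refine continuous_matrix fun i j => ?_
    simp only [Matrix.kroneckerMap_apply]
    fun_prop
  open scoped Matrix.Norms.Operator in
  exact (NormedSpace.map_exp f hf A).symm

theorem exp_one_kronecker {m n : Type*} [Fintype m] [DecidableEq m] [Fintype n] [DecidableEq n]
    (A : Matrix n n ℂ) :
    NormedSpace.exp ((1 : Matrix m m ℂ) ⊗ₖ A) = (1 : Matrix m m ℂ) ⊗ₖ NormedSpace.exp A := by
  let f : Matrix n n ℂ →+* Matrix (m × n) (m × n) ℂ :=
    { toFun := fun X => 1 ⊗ₖ X
      map_one' := by simp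
      map_mul' := fun X Y => by rw [← Matrix.mul_kronecker_mul, one_mul]
      map_zero' := by simp
      map_add' := fun X Y => Matrix.kronecker_add 1 X Y }
  have hf : Continuous f := by
    change Continuous fun X : Matrix n n ℂ => (1 : Matrix m m ℂ) ⊗ₖ X
    refine continuous_matrix fun i j => ?_
    simp only [Matrix.kroneckerMap_apply]
    fun_prop
  open scoped Matrix.Norms.Operator in
  exact (NormedSpace.map_exp f hf A).symm

/-! ### The group `K` consists of the local unitary operators -/

theorem su2_kronecker_one_eq (x y z : ℝ) : su2 x y z ⊗ₖ (1 : Matrix (Fin 2) (Fin 2) ℂ) =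
    (2 * x) • pauliX 1 0 + (2 * y) • pauliX 2 0 + (2 * z) • pauliX 3 0 := by
  ext ⟨i, i'⟩ ⟨j, j'⟩
  fin_cases i <;> fin_cases j <;> fin_cases i' <;> fin_cases j' <;>
    simp [su2, pauliX, pauli] <;> ring_nf <;> simp

theorem one_kronecker_su2_eq (x y z : ℝ) : (1 : Matrix (Fin 2) (Fin 2) ℂ) ⊗ₖ su2 x y z =
    (2 * x) • pauliX 0 1 + (2 * y) • pauliX 0 2 + (2 * z) • pauliX 0 3 := by
  ext ⟨i, i'⟩ ⟨j, j'⟩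
  fin_cases i <;> fin_cases j <;> fin_cases i' <;> fin_cases j' <;>
    simp [su2, pauliX, pauli] <;> ring_nf <;> simp

theorem su2_kronecker_one_mem (x y z : ℝ) :
    su2 x y z ⊗ₖ (1 : Matrix (Fin 2) (Fin 2) ℂ) ∈ kSpace := by
  rw [su2_kronecker_one_eq]
  have h : ∀ j : Fin 4, j ≠ 0 → pauliX j 0 ∈ kSpace := fun j hj =>
    Submodule.subset_span ⟨j, hj, Or.inr rfl⟩
  exact add_mem (add_mem (kSpace.smul_mem _ (h 1 (by decide)))
    (kSpace.smul_mem _ (h 2 (by decide)))) (kSpace.smul_mem _ (h 3 (by decide)))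

theorem one_kronecker_su2_mem (x y z : ℝ) :
    (1 : Matrix (Fin 2) (Fin 2) ℂ) ⊗ₖ su2 x y z ∈ kSpace := by
  rw [one_kronecker_su2_eq]
  have h : ∀ j : Fin 4, j ≠ 0 → pauliX 0 j ∈ kSpace := fun j hj =>
    Submodule.subset_span ⟨j, hj, Or.inl rfl⟩
  exact add_mem (add_mem (kSpace.smul_mem _ (h 1 (by decide)))
    (kSpace.smul_mem _ (h 2 (by decide)))) (kSpace.smul_mem _ (h 3 (by decide)))

theorem exists_of_mem_kSpace {X : Op} (hX : X ∈ kSpace) : ∃ x y z x' y' z' : ℝ,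
    X = su2 x y z ⊗ₖ 1 + 1 ⊗ₖ su2 x' y' z' := by
  suffices h : ∃ x y z x' y' z' : ℝ,
      X = (2 * x) • pauliX 1 0 + (2 * y) • pauliX 2 0 + (2 * z) • pauliX 3 0 +
        ((2 * x') • pauliX 0 1 + (2 * y') • pauliX 0 2 + (2 * z') • pauliX 0 3) by
    obtain ⟨x, y, z, x', y', z', h⟩ := h
    exact ⟨x, y, z, x', y', z', by rw [su2_kronecker_one_eq, one_kronecker_su2_eq, h]⟩
  induction hX using Submodule.span_induction with
  | mem X h =>
    obtain ⟨j, hj, h | h⟩ := h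
    · fin_cases j
      · exact absurd rfl hj
      · exact ⟨0, 0, 0, 1 / 2, 0, 0, by simp [h]⟩
      · exact ⟨0, 0, 0, 0, 1 / 2, 0, by simp [h]⟩
      · exact ⟨0, 0, 0, 0, 0, 1 / 2, by simp [h]⟩
    · fin_cases j
      · exact absurd rfl hj
      · exact ⟨1 / 2, 0, 0, 0, 0, 0, by simp [h]⟩
      · exact ⟨0, 1 / 2, 0, 0, 0, 0, by simp [h]⟩
      · exact ⟨0, 0, 1 / 2, 0, 0, 0, by simp [h]⟩
  | zero => exact ⟨0, 0, 0, 0, 0, 0, by simp⟩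
  | add X Y _ _ hX hY =>
    obtain ⟨x, y, z, x', y', z', rfl⟩ := hX
    obtain ⟨a, b, c, a', b', c', rfl⟩ := hY
    exact ⟨x + a, y + b, z + c, x' + a', y' + b', z' + c', by module⟩
  | smul r X _ hX =>
    obtain ⟨x, y, z, x', y', z', rfl⟩ := hX
    exact ⟨r * x, r * y, r * z, r * x', r * y', r * z', by module⟩

/-- The two summands A ⊗ 1 and 1 ⊗ B of an element of 𝔨 commute, so its exponential is exp A ⊗ exp
B. Conversely, every element of SU(2) is an exponential. -/
theorem groupK_eq_range_localHom : groupK = localHom.range := by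
  apply le_antisymm
  · rw [groupK, Subgroup.closure_le]
    rintro g ⟨X, hX, hg⟩
    obtain ⟨x, y, z, x', y', z', rfl⟩ := exists_of_mem_kSpace hX
    refine ⟨(⟨_, exp_su2_mem x y z⟩, ⟨_, exp_su2_mem x' y' z'⟩), Subtype.ext ?_⟩
    rw [hg, Matrix.exp_add_of_commute, exp_kronecker_one, exp_one_kronecker,
      ← Matrix.mul_kronecker_mul, one_mul, mul_one, coe_localHom]
    rw [Commute, SemiconjBy, ← Matrix.mul_kronecker_mul, ← Matrix.mul_kronecker_mul, one_mul,
      mul_one, one_mul, mul_one]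
  · rintro _ ⟨⟨u, v⟩, rfl⟩
    have h : ((u, v) : SU2 × SU2) = (u, 1) * (1, v) := by simp
    rw [h, map_mul]
    refine mul_mem (Subgroup.subset_closure ?_) (Subgroup.subset_closure ?_)
    · obtain ⟨x, y, z, hu⟩ := exists_eq_exp_su2 u
      refine ⟨_, su2_kronecker_one_mem x y z, ?_⟩
      rw [exp_kronecker_one, ← hu]
      rfl
    · obtain ⟨x, y, z, hv⟩ := exists_eq_exp_su2 v
      refine ⟨_, one_kronecker_su2_mem x y z, ?_⟩
      rw [exp_one_kronecker, ← hv]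
      rfl

theorem isLocalUnitary_iff_mem_groupK {g : SU4} : IsLocalUnitary g ↔ g ∈ groupK := by
  rw [isLocalUnitary_iff, groupK_eq_range_localHom]

/-! ### `𝔭` is invariant under `K` -/

/-- This basis-free description of 𝔰𝔲(2) makes invariance under unitary conjugation evident. -/
theorem su2_mem_iff {A : Matrix (Fin 2) (Fin 2) ℂ} :
    (∃ x y z : ℝ, A = su2 x y z) ↔ star A = -A ∧ A.trace = 0 := by
  constructor
  · rintro ⟨x, y, z, rfl⟩
    constructor
    · ext i j
      fin_cases i <;> fin_cases j <;> simp [su2, Matrix.star_apply, add_comm]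
    · simp [su2, Matrix.trace_fin_two]
  · rintro ⟨h, htr⟩
    rw [Matrix.trace_fin_two] at htr
    have h00 := congrFun (congrFun h 0) 0
    have h01 := congrFun (congrFun h 0) 1
    simp [Matrix.star_apply, Complex.ext_iff] at h00 h01
    rw [Complex.ext_iff] at htr
    simp at htr
    refine ⟨(A 0 1).im, (A 0 1).re, (A 0 0).im, ?_⟩
    ext i j
    fin_cases i <;> fin_cases j <;> apply Complex.ext <;> simp [su2] <;> linarith

theorem conj_su2 (u : SU2) (x y z : ℝ) : ∃ x' y' z' : ℝ,
    star (u : Matrix (Fin 2) (Fin 2) ℂ) * su2 x y z * (u : Matrix (Fin 2) (Fin 2) ℂ) =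
      su2 x' y' z' := by
  obtain ⟨h1, h2⟩ := su2_mem_iff.mp ⟨x, y, z, rfl⟩
  have hu := (Matrix.mem_specialUnitaryGroup_iff.mp u.2).1
  rw [su2_mem_iff]
  constructor
  · rw [star_mul, star_mul, star_star, h1]
    simp [mul_assoc]
  · rw [Matrix.trace_mul_comm, ← mul_assoc, Matrix.mem_unitaryGroup_iff.mp hu, one_mul, h2]

/-- The element `∑ M j k (i/2) σ_j ⊗ σ_k` of `𝔭`. -/
def pMat (M : Fin 3 → Fin 3 → ℝ) : Op := ∑ j, ∑ k, M j k • pauliX j.succ k.succ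

theorem pMat_mem (M : Fin 3 → Fin 3 → ℝ) : pMat M ∈ pSpace :=
  sum_mem fun j _ => sum_mem fun k _ => pSpace.smul_mem _
    (Submodule.subset_span ⟨j.succ, k.succ, Fin.succ_ne_zero j, Fin.succ_ne_zero k, rfl⟩)

theorem pMat_single (j k : Fin 3) :
    pMat (Pi.single j (Pi.single k 1)) = pauliX j.succ k.succ := by
  rw [pMat, Finset.sum_eq_single j, Finset.sum_eq_single k]
  · simp
  · intro b _ hb
    simp [hb]
  · simp
  · intro b _ hb
    simp [hb]
  · simp

theorem exists_eq_pMat {p : Op} (hp : p ∈ pSpace) : ∃ M, p = pMat M := by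
  induction hp using Submodule.span_induction with
  | mem X h =>
    obtain ⟨j, k, hj, hk, rfl⟩ := h
    obtain ⟨j, rfl⟩ := Fin.exists_succ_eq.mpr hj
    obtain ⟨k, rfl⟩ := Fin.exists_succ_eq.mpr hk
    exact ⟨_, (pMat_single j k).symm⟩
  | zero => exact ⟨0, by simp [pMat]⟩
  | add X Y _ _ hX hY =>
    obtain ⟨M, rfl⟩ := hX
    obtain ⟨N, rfl⟩ := hY
    exact ⟨M + N, by simp [pMat, add_smul, Finset.sum_add_distrib]⟩
  | smul r X _ hX =>
    obtain ⟨M, rfl⟩ := hX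
    exact ⟨r • M, by simp [pMat, Finset.smul_sum, mul_smul]⟩

theorem su2_kronecker_su2_mem (x y z x' y' z' : ℝ) :
    (-(I / 2)) • (su2 x y z ⊗ₖ su2 x' y' z') ∈ pSpace := by
  have : (-(I / 2)) • (su2 x y z ⊗ₖ su2 x' y' z') =
      pMat ![![x * x', x * y', x * z'], ![y * x', y * y', y * z'], ![z * x', z * y', z * z']] := by
    ext ⟨i, i'⟩ ⟨j, j'⟩
    fin_cases i <;> fin_cases j <;> fin_cases i' <;> fin_cases j' <;>
      simp [pMat, Fin.sum_univ_three, su2, pauliX, pauli, Matrix.add_apply, Matrix.smul_apply] <;>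
      ring_nf <;> simp <;> ring
  rw [this]
  exact pMat_mem _

theorem exists_pauliX_eq_su2_kronecker {j k : Fin 4} (hj : j ≠ 0) (hk : k ≠ 0) :
    ∃ x y z x' y' z' : ℝ, pauliX j k = (-(I / 2)) • (su2 x y z ⊗ₖ su2 x' y' z') := by
  have h : ∀ j : Fin 4, j ≠ 0 → ∃ x y z : ℝ, I • pauli j = su2 x y z := by
    intro j hj
    fin_cases j
    · exact absurd rfl hj
    · exact ⟨1, 0, 0, by simp [pauli, su2]⟩
    · exact ⟨0, 1, 0, by simp [pauli, su2]⟩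
    · exact ⟨0, 0, 1, by simp [pauli, su2]⟩
  obtain ⟨x, y, z, h1⟩ := h j hj
  obtain ⟨x', y', z', h2⟩ := h k hk
  refine ⟨x, y, z, x', y', z', ?_⟩
  rw [← h1, ← h2, Matrix.smul_kronecker, Matrix.kronecker_smul, smul_smul, smul_smul, pauliX]
  congr 1
  linear_combination (I / 2) * I_mul_I

theorem Ad_mem_pSpace {g : SU4} (hg : g ∈ groupK) {p : Op} (hp : p ∈ pSpace) :
    Ad g p ∈ pSpace := by
  rw [groupK_eq_range_localHom] at hg
  obtain ⟨⟨u, v⟩, rfl⟩ := hg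
  induction hp using Submodule.span_induction with
  | mem X h =>
    obtain ⟨j, k, hj, hk, rfl⟩ := h
    obtain ⟨x, y, z, x', y', z', h⟩ := exists_pauliX_eq_su2_kronecker hj hk
    obtain ⟨a, b, c, h1⟩ := conj_su2 u x y z
    obtain ⟨a', b', c', h2⟩ := conj_su2 v x' y' z'
    rw [h, Ad_apply, coe_inv_SU4, coe_localHom, Matrix.star_eq_conjTranspose,
      Matrix.conjTranspose_kronecker, mul_smul_comm, smul_mul_assoc, ← Matrix.mul_kronecker_mul,
      ← Matrix.mul_kronecker_mul, ← Matrix.star_eq_conjTranspose, ← Matrix.star_eq_conjTranspose,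
      h1, h2]
    exact su2_kronecker_su2_mem _ _ _ _ _ _
  | zero => simp
  | add X Y _ _ hX hY => rw [map_add]; exact add_mem hX hY
  | smul r X _ hX => rw [map_smul]; exact pSpace.smul_mem _ hX

/-! ### Every element of `𝔭` is conjugate under `K` to an element of `𝔞` -/

instance compactSpace_SU2 : CompactSpace SU2 := by
  apply isCompact_iff_compactSpace.mp
  have hsub : (Matrix.specialUnitaryGroup (Fin 2) ℂ : Set (Matrix (Fin 2) (Fin 2) ℂ)) ⊆
      Set.pi Set.univ fun _ => Set.pi Set.univ fun _ => Metric.closedBall (0 : ℂ) 1 := by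
    intro A hA i _ j _
    simpa using entry_norm_bound_of_unitary (Matrix.mem_specialUnitaryGroup_iff.mp hA).1 i j
  refine IsCompact.of_isClosed_subset (isCompact_univ_pi fun _ => isCompact_univ_pi fun _ =>
    isCompact_closedBall (0 : ℂ) 1) ?_ hsub
  have : (Matrix.specialUnitaryGroup (Fin 2) ℂ : Set (Matrix (Fin 2) (Fin 2) ℂ)) =
      {A | A * star A = 1} ∩ {A | A.det = 1} := by
    ext A
    simp [Matrix.mem_specialUnitaryGroup_iff, Matrix.mem_unitaryGroup_iff]
  rw [this]
  exact (isClosed_eq (by fun_prop) continuous_const).inter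
    (isClosed_eq (by fun_prop) continuous_const)

theorem neg_kronecker {m n : Type*} (A : Matrix m m ℂ) (B : Matrix n n ℂ) :
    (-A) ⊗ₖ B = -(A ⊗ₖ B) := by
  ext
  simp

theorem kronecker_neg {m n : Type*} (A : Matrix m m ℂ) (B : Matrix n n ℂ) :
    A ⊗ₖ (-B) = -(A ⊗ₖ B) := by
  ext
  simp

theorem eq_zero_of_forall_mul_le {β δ : ℝ} (h : ∀ w : ℝ, w * β ≤ δ) : β = 0 := by
  by_contra hβ
  have := h ((δ + 1) / β)
  rw [div_mul_cancel₀ _ hβ] at this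
  linarith

/-- The regular element `∑ j (i/2) σ_j ⊗ σ_j` of `𝔞`. -/
def regularA : Op := pMat ![![1, 0, 0], ![0, 2, 0], ![0, 0, 3]]

/-- First order condition at a maximum of `k ↦ Re tr (A Ad(k) q)` in the direction of a complex
structure `J`. -/
theorem re_trace_commutator_eq_zero {A q J : Op} (hJs : star J = -J)
    (hmem : ∀ c s : ℝ, c ^ 2 + s ^ 2 = 1 →
      ∃ g ∈ groupK, (g : Op) = c • (1 : Op) + s • J)
    (hmax : ∀ g ∈ groupK, (A * Ad g q).trace.re ≤ (A * q).trace.re) :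
    (A * (q * J - J * q)).trace.re = 0 := by
  apply eq_zero_of_forall_mul_le (δ := (A * q).trace.re + (A * (J * q * J)).trace.re)
  intro w
  set r := Real.sqrt (w ^ 2 + 1) with hr
  have hr2 : r ^ 2 = w ^ 2 + 1 := Real.sq_sqrt (by positivity)
  have hr0 : 0 < r := Real.sqrt_pos.mpr (by positivity)
  -- The curve g = (w + J)/√(w² + 1) avoids differentiation: after clearing denominators the w²
  -- terms of the maximality inequality cancel. What remains is linear in w and bounded above for
  -- all real w, so its slope vanishes.
  obtain ⟨g, hg, hgJ⟩ := hmem (w / r) (1 / r) (by field_simp; linarith)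
  have h := hmax g hg
  have hAd : Ad g q = (1 / r ^ 2) • (w ^ 2 • q + w • (q * J - J * q) - J * q * J) := by
    have : r ≠ 0 := hr0.ne'
    rw [Ad_apply, coe_inv_SU4, hgJ, star_add, star_smul, star_smul, star_one, hJs]
    simp only [star_trivial, add_mul, mul_add, smul_mul_assoc, mul_smul_comm, one_mul, mul_one,
      neg_mul, smul_add, smul_sub, smul_smul, smul_neg]
    module
  rw [hAd, mul_smul_comm, Matrix.trace_smul, Complex.smul_re, smul_eq_mul, one_div,
    inv_mul_le_iff₀ (by positivity), hr2, mul_sub, mul_add, mul_smul_comm, mul_smul_comm,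
    Matrix.trace_sub, Matrix.trace_add, Matrix.trace_smul, Matrix.trace_smul] at h
  simp only [Complex.sub_re, Complex.add_re, Complex.smul_re, smul_eq_mul] at h
  linarith

theorem exists_groupK_eq_left {x y z : ℝ} (h : x ^ 2 + y ^ 2 + z ^ 2 = 1) (c s : ℝ)
    (hcs : c ^ 2 + s ^ 2 = 1) : ∃ g ∈ groupK, (g : Op) = c • (1 : Op) +
      s • (su2 x y z ⊗ₖ (1 : Matrix (Fin 2) (Fin 2) ℂ)) := by
  have hu : c • (1 : Matrix (Fin 2) (Fin 2) ℂ) + s • su2 x y z ∈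
      Matrix.specialUnitaryGroup (Fin 2) ℂ := by
    rw [smul_su2]
    exact smul_one_add_su2_mem (by linear_combination hcs + s ^ 2 * h)
  refine ⟨localHom (⟨_, hu⟩, 1), by rw [groupK_eq_range_localHom]; exact ⟨_, rfl⟩, ?_⟩
  rw [coe_localHom, OneMemClass.coe_one, Matrix.add_kronecker, Matrix.smul_kronecker,
    Matrix.smul_kronecker, Matrix.one_kronecker_one]

theorem exists_groupK_eq_right {x y z : ℝ} (h : x ^ 2 + y ^ 2 + z ^ 2 = 1) (c s : ℝ)
    (hcs : c ^ 2 + s ^ 2 = 1) : ∃ g ∈ groupK, (g : Op) = c • (1 : Op) +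
      s • ((1 : Matrix (Fin 2) (Fin 2) ℂ) ⊗ₖ su2 x y z) := by
  have hu : c • (1 : Matrix (Fin 2) (Fin 2) ℂ) + s • su2 x y z ∈
      Matrix.specialUnitaryGroup (Fin 2) ℂ := by
    rw [smul_su2]
    exact smul_one_add_su2_mem (by linear_combination hcs + s ^ 2 * h)
  refine ⟨localHom (1, ⟨_, hu⟩), by rw [groupK_eq_range_localHom]; exact ⟨_, rfl⟩, ?_⟩
  rw [coe_localHom, OneMemClass.coe_one, Matrix.kronecker_add, Matrix.kronecker_smul,
    Matrix.kronecker_smul, Matrix.one_kronecker_one]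

theorem star_su2 (x y z : ℝ) : star (su2 x y z) = -su2 x y z :=
  (su2_mem_iff.mp ⟨x, y, z, rfl⟩).1

theorem re_trace_commutator_left {A q : Op} {x y z : ℝ} (h : x ^ 2 + y ^ 2 + z ^ 2 = 1)
    (hmax : ∀ g ∈ groupK, (A * Ad g q).trace.re ≤ (A * q).trace.re) :
    (A * (q * (su2 x y z ⊗ₖ 1) - (su2 x y z ⊗ₖ 1) * q)).trace.re = 0 := by
  refine re_trace_commutator_eq_zero ?_ (exists_groupK_eq_left h) hmax
  rw [Matrix.star_eq_conjTranspose, Matrix.conjTranspose_kronecker,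
    ← Matrix.star_eq_conjTranspose, star_su2]
  simp [neg_kronecker]

theorem re_trace_commutator_right {A q : Op} {x y z : ℝ} (h : x ^ 2 + y ^ 2 + z ^ 2 = 1)
    (hmax : ∀ g ∈ groupK, (A * Ad g q).trace.re ≤ (A * q).trace.re) :
    (A * (q * (1 ⊗ₖ su2 x y z) - (1 ⊗ₖ su2 x y z) * q)).trace.re = 0 := by
  refine re_trace_commutator_eq_zero ?_ (exists_groupK_eq_right h) hmax
  rw [Matrix.star_eq_conjTranspose, Matrix.conjTranspose_kronecker,
    ← Matrix.star_eq_conjTranspose, ← Matrix.star_eq_conjTranspose, star_su2]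
  simp [kronecker_neg]

set_option maxHeartbeats 1600000 in
theorem pMat_mem_aSpace_of_maximal {M : Fin 3 → Fin 3 → ℝ}
    (hmax : ∀ g ∈ groupK,
      (regularA * Ad g (pMat M)).trace.re ≤ (regularA * pMat M).trace.re) :
    pMat M ∈ aSpace := by
  have hl1 := re_trace_commutator_left (x := 1) (y := 0) (z := 0) (by norm_num) hmax
  have hl2 := re_trace_commutator_left (x := 0) (y := 1) (z := 0) (by norm_num) hmax
  have hl3 := re_trace_commutator_left (x := 0) (y := 0) (z := 1) (by norm_num) hmax
  have hr1 := re_trace_commutator_right (x := 1) (y := 0) (z := 0) (by norm_num) hmax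
  have hr2 := re_trace_commutator_right (x := 0) (y := 1) (z := 0) (by norm_num) hmax
  have hr3 := re_trace_commutator_right (x := 0) (y := 0) (z := 1) (by norm_num) hmax
  simp [regularA, pMat, Fin.sum_univ_three, su2, pauliX, pauli, Matrix.trace, Matrix.mul_apply,
    Fintype.sum_prod_type, Fin.sum_univ_two, Matrix.add_apply, Matrix.smul_apply]
    at hl1 hl2 hl3 hr1 hr2 hr3
  -- With weights a = (1, 2, 3), the left and right conditions for the pair j, k amount to a_j M_kj
  -- = a_k M_jk and a_k M_kj = a_j M_jk. Their determinant is ±(a_j² - a_k²) ≠ 0, which is why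
  -- `regularA` has entries with distinct squares.
  have h : ∀ j k : Fin 3, j ≠ k → M j k = 0 := by
    intro j k hjk
    fin_cases j <;> fin_cases k <;> first | exact absurd rfl hjk | (simp; linarith)
  have hM : pMat M = ∑ j, M j j • pauliX j.succ j.succ :=
    Finset.sum_congr rfl fun j _ => Finset.sum_eq_single j
      (fun k _ hk => by rw [h j k hk.symm, zero_smul]) (by simp)
  rw [hM]
  exact sum_mem fun j _ => aSpace.smul_mem _
    (Submodule.subset_span ⟨j.succ, Fin.succ_ne_zero j, rfl⟩)

/-- On the compact group K the function k ↦ Re tr(A Ad(k) p), with A regular in 𝔞, attains its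
maximum; the first order conditions there force Ad(k) p into 𝔞. -/
theorem exists_Ad_mem_aSpace {p : Op} (hp : p ∈ pSpace) : ∃ k ∈ groupK, Ad k p ∈ aSpace := by
  have hcont : Continuous fun g : SU2 × SU2 => (regularA * Ad (localHom g) p).trace.re := by
    have h1 : Continuous fun g : SU2 × SU2 => (localHom g : Op) := by
      refine continuous_matrix fun i j => ?_
      change Continuous fun g : SU2 × SU2 => (g.1 : Matrix (Fin 2) (Fin 2) ℂ) i.1 j.1 *
        (g.2 : Matrix (Fin 2) (Fin 2) ℂ) i.2 j.2
      exact ((continuous_subtype_val.comp continuous_fst).matrix_elem _ _).mul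
        ((continuous_subtype_val.comp continuous_snd).matrix_elem _ _)
    have h2 : (fun g : SU2 × SU2 => (regularA * Ad (localHom g) p).trace.re) =
        fun g => (regularA * (star (localHom g : Op) * p * (localHom g : Op))).trace.re := rfl
    rw [h2]
    fun_prop
  obtain ⟨g, -, hg⟩ := isCompact_univ.exists_isMaxOn Set.univ_nonempty hcont.continuousOn
  have hgK : localHom g ∈ groupK := by rw [groupK_eq_range_localHom]; exact ⟨g, rfl⟩
  refine ⟨localHom g, hgK, ?_⟩
  obtain ⟨M, hM⟩ := exists_eq_pMat (Ad_mem_pSpace hgK hp)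
  rw [hM]
  apply pMat_mem_aSpace_of_maximal
  intro h hh
  rw [groupK_eq_range_localHom] at hh
  obtain ⟨h, rfl⟩ := hh
  -- Because K is a group, maximality at g for p is maximality at the identity for Ad(g) p.
  rw [← hM, ← Ad_mul, ← map_mul]
  exact hg (Set.mem_univ (g * h))

/-! ### The Bell basis -/

/-- The matrix whose columns are the four Bell vectors, of norm `√2`. -/
def bell : Matrix (Fin 2 × Fin 2) (Fin 4) ℂ :=
  Matrix.of fun i => ![![![0, 1, 1, 0], ![1, 0, 0, 1]], ![![-1, 0, 0, 1], ![0, -1, 1, 0]]] i.1 i.2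

theorem bell_conjTranspose_mul : bellᴴ * bell = (2 : ℂ) • (1 : Matrix (Fin 4) (Fin 4) ℂ) := by
  ext i j
  fin_cases i <;> fin_cases j <;>
    simp [bell, Matrix.mul_apply, Fintype.sum_prod_type, Fin.sum_univ_two] <;> norm_num

theorem bell_mul_conjTranspose : bell * bellᴴ = (2 : ℂ) • (1 : Op) := by
  ext ⟨i, i'⟩ ⟨j, j'⟩
  fin_cases i <;> fin_cases i' <;> fin_cases j <;> fin_cases j' <;>
    simp [bell, Matrix.mul_apply, Fin.sum_univ_four] <;> norm_num

/-- The operator with eigenvalues `i d₀, …, i d₃` in the Bell basis. -/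
def bellDiag : (Fin 4 → ℝ) →ₗ[ℝ] Op where
  toFun d := (I / 2) • (bell * Matrix.diagonal (fun i => (d i : ℂ)) * bellᴴ)
  map_add' d e := by
    rw [← smul_add, ← Matrix.add_mul, ← Matrix.mul_add, Matrix.diagonal_add]
    simp
  map_smul' r d := by
    have : (Matrix.diagonal fun i => (((r • d) i : ℝ) : ℂ)) =
        r • Matrix.diagonal fun i => (d i : ℂ) := by
      ext i j
      by_cases h : i = j <;> simp [h]
    rw [this, Matrix.mul_smul, Matrix.smul_mul, smul_comm]
    rfl

theorem bellDiag_apply (d : Fin 4 → ℝ) :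
    bellDiag d = (I / 2) • (bell * Matrix.diagonal (fun i => (d i : ℂ)) * bellᴴ) := rfl

theorem bellDiag_eq {d : Fin 4 → ℝ} (hd : ∑ i, d i = 0) : bellDiag d =
    (-d 0 - d 1) • pauliX 1 1 + (-d 0 - d 2) • pauliX 2 2 + (-d 0 - d 3) • pauliX 3 3 := by
  have h3 : d 3 = -d 0 - d 1 - d 2 := by
    rw [Fin.sum_univ_four] at hd
    linarith
  ext ⟨i, i'⟩ ⟨j, j'⟩
  rw [bellDiag_apply]
  fin_cases i <;> fin_cases i' <;> fin_cases j <;> fin_cases j' <;>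
    simp [bell, Matrix.mul_apply, Fin.sum_univ_four, pauliX, pauli, Matrix.diagonal_apply, h3] <;>
    ring_nf

theorem mem_aSpace_iff {a : Op} :
    a ∈ aSpace ↔ ∃ d : Fin 4 → ℝ, ∑ i, d i = 0 ∧ a = bellDiag d := by
  constructor
  · intro ha
    induction ha using Submodule.span_induction with
    | mem X h =>
      obtain ⟨j, hj, rfl⟩ := h
      fin_cases j
      · exact absurd rfl hj
      -- The witnesses here and in the next two cases are the eigenvalues of ½ σ_j ⊗ σ_j on the four
      -- Bell vectors.
      · refine ⟨![-1 / 2, -1 / 2, 1 / 2, 1 / 2], by simp [Fin.sum_univ_four]; norm_num, ?_⟩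
        rw [bellDiag_eq (by simp [Fin.sum_univ_four]; norm_num)]
        simp; norm_num
      · refine ⟨![-1 / 2, 1 / 2, -1 / 2, 1 / 2], by simp [Fin.sum_univ_four]; norm_num, ?_⟩
        rw [bellDiag_eq (by simp [Fin.sum_univ_four]; norm_num)]
        simp; norm_num
      · refine ⟨![-1 / 2, 1 / 2, 1 / 2, -1 / 2], by simp [Fin.sum_univ_four]; norm_num, ?_⟩
        rw [bellDiag_eq (by simp [Fin.sum_univ_four]; norm_num)]
        simp; norm_num
    | zero => exact ⟨0, by simp, by simp⟩
    | add X Y _ _ hX hY =>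
      obtain ⟨d, hd, rfl⟩ := hX
      obtain ⟨e, he, rfl⟩ := hY
      exact ⟨d + e, by simp [Finset.sum_add_distrib, hd, he], (map_add _ _ _).symm⟩
    | smul r X _ hX =>
      obtain ⟨d, hd, rfl⟩ := hX
      exact ⟨r • d, by simp [← Finset.mul_sum, hd], (map_smul _ _ _).symm⟩
  · rintro ⟨d, hd, rfl⟩
    rw [bellDiag_eq hd]
    have h : ∀ j : Fin 4, j ≠ 0 → pauliX j j ∈ aSpace := fun j hj =>
      Submodule.subset_span ⟨j, hj, rfl⟩
    exact add_mem (add_mem (aSpace.smul_mem _ (h 1 (by decide)))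
      (aSpace.smul_mem _ (h 2 (by decide)))) (aSpace.smul_mem _ (h 3 (by decide)))

/-! ### The Weyl group permutes the eigenvalues in the Bell basis -/

theorem exists_quarter_turn {x y z x' y' z' : ℝ} (h : x ^ 2 + y ^ 2 + z ^ 2 = 1)
    (h' : x' ^ 2 + y' ^ 2 + z' ^ 2 = 1) : ∃ g ∈ groupK,
      (g : Op) = (1 / 2 : ℝ) • ((1 + su2 x y z) ⊗ₖ (1 + su2 x' y' z')) := by
  set r : ℝ := Real.sqrt 2 / 2 with hr
  have hr2 : r * r = 1 / 2 := by
    rw [hr, div_mul_div_comm, Real.mul_self_sqrt (by norm_num)]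
    norm_num
  have hm : ∀ {x y z : ℝ}, x ^ 2 + y ^ 2 + z ^ 2 = 1 →
      r • (1 + su2 x y z) ∈ Matrix.specialUnitaryGroup (Fin 2) ℂ := by
    intro x y z h
    rw [smul_add, smul_su2]
    exact smul_one_add_su2_mem (by linear_combination r * r * h + 2 * hr2)
  refine ⟨localHom (⟨_, hm h⟩, ⟨_, hm h'⟩), by rw [groupK_eq_range_localHom]; exact ⟨_, rfl⟩, ?_⟩
  rw [coe_localHom, Matrix.smul_kronecker, Matrix.kronecker_smul, smul_smul, hr2]

theorem Ad_eq_of_mul_eq {g : SU4} {X Y : Op} (h : X * (g : Op) = (g : Op) * Y) : Ad g X = Y := by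
  rw [Ad_apply, mul_assoc, h, ← mul_assoc, coe_inv_mul_self, one_mul]

-- A pair of quarter turns about the same coordinate axis, in equal senses, exchanges the
-- coefficients of the other two σ_j ⊗ σ_j; in opposite senses it exchanges them with a change of
-- sign. By `bellDiag_eq`, on trace-zero d these are transpositions of Bell eigenvalues. Opposite
-- senses are needed only for the pair 0, 1, which involves the singlet.
set_option maxHeartbeats 1000000 in
theorem exists_Ad_bellDiag_swap (i : Fin 3) : ∃ k ∈ groupK, ∀ d : Fin 4 → ℝ,
    Ad k (bellDiag d) = bellDiag (d ∘ Equiv.swap i.castSucc i.succ) := by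
  have key : ∀ (x y z x' y' z' : ℝ), x ^ 2 + y ^ 2 + z ^ 2 = 1 → x' ^ 2 + y' ^ 2 + z' ^ 2 = 1 →
      (∀ d : Fin 4 → ℝ,
        bellDiag d * ((1 + su2 x y z) ⊗ₖ (1 + su2 x' y' z')) =
        ((1 + su2 x y z) ⊗ₖ (1 + su2 x' y' z')) *
          bellDiag (d ∘ Equiv.swap i.castSucc i.succ)) →
      ∃ k ∈ groupK, ∀ d : Fin 4 → ℝ,
        Ad k (bellDiag d) = bellDiag (d ∘ Equiv.swap i.castSucc i.succ) := by
    intro x y z x' y' z' h h' hd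
    obtain ⟨g, hg, hgX⟩ := exists_quarter_turn h h'
    refine ⟨g, hg, fun d => Ad_eq_of_mul_eq ?_⟩
    rw [hgX, mul_smul_comm, smul_mul_assoc, hd]
  have h01 : Equiv.swap (0 : Fin 4) 1 2 = 2 := by decide
  have h01' : Equiv.swap (0 : Fin 4) 1 3 = 3 := by decide
  have h12 : Equiv.swap (1 : Fin 4) 2 0 = 0 := by decide
  have h12' : Equiv.swap (1 : Fin 4) 2 3 = 3 := by decide
  have h23 : Equiv.swap (2 : Fin 4) 3 0 = 0 := by decide
  have h23' : Equiv.swap (2 : Fin 4) 3 1 = 1 := by decide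
  fin_cases i
  · refine key 1 0 0 (-1) 0 0 (by norm_num) (by norm_num) fun d => ?_
    rw [bellDiag_apply, bellDiag_apply, smul_mul_assoc, mul_smul_comm]
    congr 1
    ext ⟨i, i'⟩ ⟨j, j'⟩
    fin_cases i <;> fin_cases i' <;> fin_cases j <;> fin_cases j' <;>
      simp [bell, Matrix.mul_apply, Fin.sum_univ_four, su2, Matrix.diagonal_apply,
        Fintype.sum_prod_type, h01, h01'] <;>
      ring_nf
  · refine key 0 0 1 0 0 1 (by norm_num) (by norm_num) fun d => ?_
    rw [bellDiag_apply, bellDiag_apply, smul_mul_assoc, mul_smul_comm]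
    congr 1
    ext ⟨i, i'⟩ ⟨j, j'⟩
    fin_cases i <;> fin_cases i' <;> fin_cases j <;> fin_cases j' <;>
      simp [bell, Matrix.mul_apply, Fin.sum_univ_four, su2, Matrix.diagonal_apply,
        Fintype.sum_prod_type, h12, h12'] <;>
      ring_nf <;> simp <;> ring
  · refine key 1 0 0 1 0 0 (by norm_num) (by norm_num) fun d => ?_
    rw [bellDiag_apply, bellDiag_apply, smul_mul_assoc, mul_smul_comm]
    congr 1
    ext ⟨i, i'⟩ ⟨j, j'⟩
    fin_cases i <;> fin_cases i' <;> fin_cases j <;> fin_cases j' <;>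
      simp [bell, Matrix.mul_apply, Fin.sum_univ_four, su2, Matrix.diagonal_apply,
        Fintype.sum_prod_type, h23, h23'] <;>
      ring_nf

theorem exists_Ad_bellDiag_perm (π : Equiv.Perm (Fin 4)) : ∃ k ∈ groupK, ∀ d : Fin 4 → ℝ,
    Ad k (bellDiag d) = bellDiag (d ∘ π) := by
  have hπ : π ∈ Submonoid.closure
      (Set.range fun i : Fin 3 => Equiv.swap i.castSucc i.succ) := by
    rw [Equiv.Perm.mclosure_swap_castSucc_succ]
    trivial
  induction hπ using Submonoid.closure_induction with
  | mem π h =>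
    obtain ⟨i, rfl⟩ := h
    exact exists_Ad_bellDiag_swap i
  | one => exact ⟨1, one_mem _, fun d => by simp⟩
  | mul π ρ _ _ hπ hρ =>
    obtain ⟨k, hk, h⟩ := hπ
    obtain ⟨l, hl, h'⟩ := hρ
    refine ⟨k * l, mul_mem hk hl, fun d => ?_⟩
    rw [Ad_mul, h, h']
    rfl

theorem bellDiag_comp_perm_mem_weylOrbit {p : Op} {k : SU4} (hk : k ∈ groupK) {d : Fin 4 → ℝ}
    (hd : ∑ i, d i = 0) (hp : Ad k p = bellDiag d) (π : Equiv.Perm (Fin 4)) :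
    bellDiag (d ∘ π) ∈ weylOrbit p := by
  obtain ⟨g, hg, hgd⟩ := exists_Ad_bellDiag_perm π
  have hN : g ∈ normalizerK := by
    refine ⟨hg, fun X hX => ?_⟩
    obtain ⟨e, he, rfl⟩ := mem_aSpace_iff.mp hX
    rw [hgd, mem_aSpace_iff]
    exact ⟨_, by simpa [Equiv.sum_comp π] using he, rfl⟩
  refine ⟨⟨bellDiag d, mem_aSpace_iff.mpr ⟨d, hd, rfl⟩⟩, ⟨k, hk, hp.symm⟩,
    QuotientGroup.mk ⟨g, hN⟩, ?_⟩
  rw [weylAct_mk]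
  exact (hgd d).symm

/-! ### Doubly stochastic matrices -/

/-- Birkhoff's theorem, pushed forward along the linear map S ↦ `bellDiag (S *ᵥ d)`, which sends
permutation matrices into the Weyl orbit. -/
theorem bellDiag_mulVec_mem_convexHull {p : Op} {k : SU4} (hk : k ∈ groupK) {d : Fin 4 → ℝ}
    (hd : ∑ i, d i = 0) (hp : Ad k p = bellDiag d) {S : Matrix (Fin 4) (Fin 4) ℝ}
    (hS : S ∈ doublyStochastic ℝ (Fin 4)) :
    bellDiag (S *ᵥ d) ∈ convexHull ℝ (weylOrbit p) := by
  let f : Matrix (Fin 4) (Fin 4) ℝ →ₗ[ℝ] Op :=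
    bellDiag ∘ₗ (Matrix.mulVecBilin ℝ ℝ).flip d
  have hf : ∀ S, f S = bellDiag (S *ᵥ d) := fun S => rfl
  rw [← hf]
  have hS' : S ∈ convexHull ℝ {σ.permMatrix ℝ | σ : Equiv.Perm (Fin 4)} := by
    rw [← doublyStochastic_eq_convexHull_permMatrix]
    exact hS
  have h := Set.mem_image_of_mem f hS'
  rw [f.image_convexHull] at h
  refine convexHull_mono ?_ h
  rintro _ ⟨_, ⟨π, rfl⟩, rfl⟩
  rw [hf, Matrix.permMatrix_mulVec]
  exact bellDiag_comp_perm_mem_weylOrbit hk hd hp π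

/-- The squared absolute values of the entries of a unitary operator in the Bell basis. -/
def bellStochastic (V : SU4) : Matrix (Fin 4) (Fin 4) ℝ :=
  Matrix.of fun i j => Complex.normSq ((bellᴴ * (V : Op) * bell) j i) / 4

theorem sum_normSq_row {n : Type*} [Fintype n] [DecidableEq n] {W : Matrix n n ℂ} {r : ℝ}
    (h : W * Wᴴ = (r : ℂ) • (1 : Matrix n n ℂ)) (i : n) : ∑ j, Complex.normSq (W i j) = r := by
  have h1 := congrFun (congrFun h i) i
  simp only [Matrix.mul_apply, Matrix.conjTranspose_apply, Matrix.smul_apply, Matrix.one_apply_eq,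
    smul_eq_mul, mul_one] at h1
  rw [← Complex.ofReal_inj, ← h1]
  push_cast
  exact Finset.sum_congr rfl fun j _ => (Complex.mul_conj _).symm

/-- The Bell vectors have norm √2, so W is twice a unitary matrix and its squared absolute values
sum to 4 along rows and columns. -/
theorem bellStochastic_mem (V : SU4) : bellStochastic V ∈ doublyStochastic ℝ (Fin 4) := by
  set W := bellᴴ * (V : Op) * bell with hW
  have hV := (Matrix.mem_specialUnitaryGroup_iff.mp V.2).1
  have hV1 : (V : Op) * (V : Op)ᴴ = 1 := Matrix.mem_unitaryGroup_iff.mp hV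
  have hV2 : (V : Op)ᴴ * (V : Op) = 1 := Matrix.mem_unitaryGroup_iff'.mp hV
  have hWs : Wᴴ = bellᴴ * (V : Op)ᴴ * bell := by
    simp [hW, Matrix.conjTranspose_mul, Matrix.mul_assoc]
  have h1 : W * Wᴴ = ((4 : ℝ) : ℂ) • (1 : Matrix (Fin 4) (Fin 4) ℂ) := by
    calc W * Wᴴ = bellᴴ * ((V : Op) * (bell * bellᴴ) * (V : Op)ᴴ) * bell := by
          rw [hWs, hW]; simp only [Matrix.mul_assoc]
      _ = _ := by
          rw [bell_mul_conjTranspose, mul_smul_comm, mul_one, smul_mul_assoc, hV1]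
          simp only [Matrix.mul_smul, Matrix.smul_mul, Matrix.mul_one, bell_conjTranspose_mul,
            smul_smul]
          norm_num
  have h2 : Wᴴ * W = ((4 : ℝ) : ℂ) • (1 : Matrix (Fin 4) (Fin 4) ℂ) := by
    calc Wᴴ * W = bellᴴ * ((V : Op)ᴴ * (bell * bellᴴ) * (V : Op)) * bell := by
          rw [hWs, hW]; simp only [Matrix.mul_assoc]
      _ = _ := by
          rw [bell_mul_conjTranspose, mul_smul_comm, mul_one, smul_mul_assoc, hV2]
          simp only [Matrix.mul_smul, Matrix.smul_mul, Matrix.mul_one, bell_conjTranspose_mul,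
            smul_smul]
          norm_num
  rw [mem_doublyStochastic_iff_sum]
  refine ⟨fun i j => div_nonneg (Complex.normSq_nonneg _) (by norm_num), fun i => ?_, fun j => ?_⟩
  · have := sum_normSq_row (W := Wᴴ) (by rw [Matrix.conjTranspose_conjTranspose, h2]) i
    simp only [Matrix.conjTranspose_apply, RCLike.star_def, Complex.normSq_conj] at this
    simp only [bellStochastic, Matrix.of_apply]
    rw [← Finset.sum_div, this]
    norm_num
  · simp only [bellStochastic, Matrix.of_apply]
    rw [← Finset.sum_div, sum_normSq_row h1]
    norm_num

/-- The imaginary parts of the diagonal entries in the Bell basis. -/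
def bellCoeff (i : Fin 4) : Op →ₗ[ℝ] ℝ where
  toFun X := ((bellᴴ * X * bell) i i).im / 2
  map_add' X Y := by simp [Matrix.mul_add, Matrix.add_mul, add_div]
  map_smul' r X := by simp [Matrix.mul_smul, Matrix.smul_mul, mul_div_assoc]

theorem bellCoeff_apply (i : Fin 4) (X : Op) :
    bellCoeff i X = ((bellᴴ * X * bell) i i).im / 2 := rfl

theorem bellCoeff_bellDiag (d : Fin 4 → ℝ) (i : Fin 4) : bellCoeff i (bellDiag d) = d i := by
  have : bellᴴ * bellDiag d * bell = (2 * I) • Matrix.diagonal (fun i => (d i : ℂ)) := by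
    calc bellᴴ * bellDiag d * bell =
        (I / 2) • ((bellᴴ * bell) * Matrix.diagonal (fun i => (d i : ℂ)) * (bellᴴ * bell)) := by
          rw [bellDiag_apply]
          simp only [Matrix.mul_smul, Matrix.smul_mul, Matrix.mul_assoc]
      _ = _ := by
          rw [bell_conjTranspose_mul]
          simp only [Matrix.mul_smul, Matrix.smul_mul, Matrix.mul_one, Matrix.one_mul, smul_smul]
          congr 1
          ring
  simp [bellCoeff_apply, this]

/-- Schur's observation: the i-th diagonal entry of a conjugated diagonal matrix is the average of
the eigenvalues with weights |W_ji|². No locality of V is needed. -/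
theorem bellCoeff_Ad_bellDiag (V : SU4) (d : Fin 4 → ℝ) (i : Fin 4) :
    bellCoeff i (Ad V (bellDiag d)) = (bellStochastic V *ᵥ d) i := by
  set W := bellᴴ * (V : Op) * bell with hW
  have h : bellᴴ * Ad V (bellDiag d) * bell =
      (I / 2) • (Wᴴ * (Matrix.diagonal (fun i => (d i : ℂ)) * W)) := by
    rw [Ad_apply, coe_inv_SU4, bellDiag_apply, hW, Matrix.star_eq_conjTranspose]
    simp only [Matrix.mul_smul, Matrix.smul_mul, Matrix.mul_assoc, Matrix.conjTranspose_mul,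
      Matrix.conjTranspose_conjTranspose]
  have h2 : (Wᴴ * (Matrix.diagonal (fun i => (d i : ℂ)) * W)) i i =
      ((∑ j, Complex.normSq (W j i) * d j : ℝ) : ℂ) := by
    rw [Matrix.mul_apply]
    push_cast
    refine Finset.sum_congr rfl fun j _ => ?_
    rw [Matrix.diagonal_mul, Matrix.conjTranspose_apply, ← Complex.mul_conj, RCLike.star_def]
    ring
  rw [bellCoeff_apply, h, Matrix.smul_apply, h2, smul_eq_mul, Complex.im_mul_ofReal]
  simp only [Matrix.mulVec, dotProduct, bellStochastic, Matrix.of_apply, ← hW]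
  rw [Finset.mul_sum, Finset.sum_div]
  refine Finset.sum_congr rfl fun j _ => ?_
  simp
  ring

theorem continuous_bellCoeff (i : Fin 4) : Continuous (bellCoeff i) := by
  have : Continuous fun X : Op => (bellᴴ * X * bell) i i :=
    ((continuous_const.matrix_mul continuous_id).matrix_mul continuous_const).matrix_elem i i
  exact (Complex.continuous_im.comp this).div_const 2

/-- Entries of doubly stochastic matrices lie in [0, 1], so c dominates every entrywise series, and
the row and column sums pass to the limit. -/
theorem exists_doublyStochastic_hasSum {n : Type*} [Fintype n] [DecidableEq n]
    {c : ℕ → ℝ} (hc : ∀ j, 0 ≤ c j) (hsum : HasSum c 1) {S : ℕ → Matrix n n ℝ}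
    (hS : ∀ j, S j ∈ doublyStochastic ℝ n) :
    ∃ T ∈ doublyStochastic ℝ n, ∀ i k, HasSum (fun j => c j * S j i k) (T i k) := by
  have hs : ∀ i k, Summable fun j => c j * S j i k := fun i k =>
    Summable.of_nonneg_of_le
      (fun j => mul_nonneg (hc j) (nonneg_of_mem_doublyStochastic (hS j)))
      (fun j => mul_le_of_le_one_right (hc j) (le_one_of_mem_doublyStochastic (hS j)))
      hsum.summable
  refine ⟨Matrix.of fun i k => ∑' j, c j * S j i k, ?_, fun i k => (hs i k).hasSum⟩
  rw [mem_doublyStochastic_iff_sum]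
  refine ⟨fun i k => tsum_nonneg fun j =>
    mul_nonneg (hc j) (nonneg_of_mem_doublyStochastic (hS j)), fun i => ?_, fun k => ?_⟩
  · refine (hasSum_sum fun k _ => (hs i k).hasSum).unique ?_
    simpa [← Finset.mul_sum, sum_row_of_mem_doublyStochastic (hS _)] using hsum
  · refine (hasSum_sum fun i _ => (hs i k).hasSum).unique ?_
    simpa [← Finset.mul_sum, sum_col_of_mem_doublyStochastic (hS _)] using hsum

/-- The individual terms need not lie in 𝔞, but the sum does, so its Bell diagonal determines it;
taking diagonals termwise expresses it through one doubly stochastic matrix. -/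
theorem smul_mem_convexHull_of_hasSum {p a' : Op} {k : SU4} (hk : k ∈ groupK)
    (hkp : Ad k p ∈ aSpace) (ha' : a' ∈ aSpace) {t : ℝ} (ht : 0 < t) {c : ℕ → ℝ}
    (hc : ∀ j, 0 ≤ c j) (hct : HasSum c t) {V : ℕ → SU4}
    (h : HasSum (fun j => c j • Ad (V j) p) a') :
    t⁻¹ • a' ∈ convexHull ℝ (weylOrbit p) := by
  obtain ⟨d, hd, hp⟩ := mem_aSpace_iff.mp hkp
  obtain ⟨e, -, rfl⟩ := mem_aSpace_iff.mp ha'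
  have hpV : ∀ j, Ad (V j) p = Ad (k⁻¹ * V j) (bellDiag d) := fun j => by
    rw [← hp, Ad_mul, Ad_inv_Ad]
  obtain ⟨T, hT, hTS⟩ := exists_doublyStochastic_hasSum (c := fun j => t⁻¹ * c j)
    (fun j => mul_nonneg (inv_nonneg.mpr ht.le) (hc j))
    (by simpa [ht.ne'] using hct.mul_left t⁻¹) (fun j => bellStochastic_mem (k⁻¹ * V j))
  have he : t⁻¹ • e = T *ᵥ d := by
    funext i
    have h1 : HasSum (fun j => c j * (bellStochastic (k⁻¹ * V j) *ᵥ d) i) (e i) := by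
      have := h.map (bellCoeff i) (continuous_bellCoeff i)
      simpa only [Function.comp_def, map_smul, smul_eq_mul, hpV,
        bellCoeff_Ad_bellDiag, bellCoeff_bellDiag] using this
    refine (h1.mul_left t⁻¹).unique ?_
    have h2 := hasSum_sum (s := Finset.univ) fun k _ => (hTS i k).mul_right (d k)
    have h3 : (T *ᵥ d) i = ∑ k, T i k * d k := rfl
    rw [h3]
    convert h2 using 2 with j
    simp only [Matrix.mulVec, dotProduct, Finset.mul_sum]
    exact Finset.sum_congr rfl fun _ _ => by ring
  rw [← map_smul, he]
  exact bellDiag_mulVec_mem_convexHull hk hd hp hT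

/-! ### Norm estimates for products of exponentials -/

section NormEstimates

variable {R : Type*} [NormedRing R]

theorem norm_exp_sub_one_sub_le [NormedAlgebra ℝ R] [CompleteSpace R] (Y : R) :
    ‖NormedSpace.exp Y - 1 - Y‖ ≤ Real.exp ‖Y‖ - 1 - ‖Y‖ := by
  have h1 := (hasSum_nat_add_iff' 2).mpr (NormedSpace.exp_series_hasSum_exp' (𝕂 := ℝ) Y)
  have h2 := (hasSum_nat_add_iff' 2).mpr (NormedSpace.exp_series_hasSum_exp' (𝕂 := ℝ) ‖Y‖)
  rw [← Real.exp_eq_exp_ℝ] at h2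
  simp only [Finset.sum_range_succ, Finset.sum_range_zero, Nat.factorial_zero, Nat.cast_one,
    inv_one, pow_zero, one_smul, zero_add, Nat.factorial_one, pow_one, ← sub_sub] at h1 h2
  refine h1.norm_le_of_bounded h2 fun n => ?_
  rw [norm_smul, norm_inv, RCLike.norm_natCast, smul_eq_mul]
  gcongr
  exact norm_pow_le' Y (by omega)

theorem norm_exp_sub_one_le [NormedAlgebra ℝ R] [CompleteSpace R] (Y : R) :
    ‖NormedSpace.exp Y - 1‖ ≤ Real.exp ‖Y‖ - 1 := by
  have h := norm_add_le (NormedSpace.exp Y - 1 - Y) Y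
  rw [sub_add_cancel] at h
  linarith [norm_exp_sub_one_sub_le Y]

theorem exp_sub_one_sub_mono {x y : ℝ} (hx : 0 ≤ x) (hxy : x ≤ y) :
    Real.exp x - 1 - x ≤ Real.exp y - 1 - y := by
  have h1 : Real.exp y = Real.exp x * Real.exp (y - x) := by
    rw [← Real.exp_add]; ring_nf
  have h2 := Real.add_one_le_exp (y - x)
  have h3 := Real.one_le_exp hx
  nlinarith [Real.exp_pos x]

/-- `E` is within the errors of an exponential of `Y`, where `‖Y‖ ≤ x`. -/
def ExpApprox (E Y : R) (x : ℝ) : Prop :=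
  0 ≤ x ∧ ‖E - 1‖ ≤ Real.exp x - 1 ∧ ‖E - 1 - Y‖ ≤ Real.exp x - 1 - x

theorem expApprox_one : ExpApprox (1 : R) 0 0 := by
  simp [ExpApprox]

theorem expApprox_exp [NormedAlgebra ℝ R] [CompleteSpace R] {Y : R} {x : ℝ} (h : ‖Y‖ ≤ x) :
    ExpApprox (NormedSpace.exp Y) Y x :=
  ⟨(norm_nonneg _).trans h,
    (norm_exp_sub_one_le Y).trans (by gcongr),
    (norm_exp_sub_one_sub_le Y).trans (exp_sub_one_sub_mono (norm_nonneg _) h)⟩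

/-- Expand EG - 1 as (E - 1)(G - 1) + (E - 1) + (G - 1). The same identity for real exponentials
shows that the bounds combine exactly, so no error accumulates with the number of factors. -/
theorem ExpApprox.mul {E Y G L : R} {x y : ℝ} (hE : ExpApprox E Y x) (hG : ExpApprox G L y) :
    ExpApprox (E * G) (L + Y) (y + x) := by
  obtain ⟨hx, hE1, hE2⟩ := hE
  obtain ⟨hy, hG1, hG2⟩ := hG
  have hEG : ‖(E - 1) * (G - 1)‖ ≤ (Real.exp x - 1) * (Real.exp y - 1) :=
    (norm_mul_le _ _).trans (mul_le_mul hE1 hG1 (norm_nonneg _) ((norm_nonneg _).trans hE1))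
  refine ⟨add_nonneg hy hx, ?_, ?_⟩
  · have : E * G - 1 = (E - 1) * (G - 1) + (E - 1) + (G - 1) := by noncomm_ring
    rw [this, Real.exp_add]
    refine (norm_add₃_le).trans ?_
    linarith
  · have : E * G - 1 - (L + Y) = (E - 1) * (G - 1) + (E - 1 - Y) + (G - 1 - L) := by noncomm_ring
    rw [this, Real.exp_add]
    refine (norm_add₃_le).trans ?_
    linarith

end NormEstimates

/-- The bound is o(s), being the first order remainder of s ↦ exp(sk); at s = 0 it also forces F 0 =
A. -/
theorem hasDerivWithinAt_of_norm_le {E : Type*} [NormedAddCommGroup E] [NormedSpace ℝ E]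
    {F : ℝ → E} {A D : E} {k : ℝ}
    (h : ∀ s : ℝ, 0 ≤ s → ‖F s - A - s • D‖ ≤ Real.exp (s * k) - 1 - s * k) :
    HasDerivWithinAt F D (Set.Ici 0) 0 := by
  have h0 : F 0 = A := by
    have := h 0 le_rfl
    simpa [sub_eq_zero] using this
  have hd : HasDerivAt (fun s : ℝ => Real.exp (s * k)) k 0 := by
    simpa using ((hasDerivAt_id (0 : ℝ)).mul_const k).exp
  rw [hasDerivWithinAt_iff_isLittleO, h0]
  refine Asymptotics.IsBigO.trans_isLittleO ?_
    (hasDerivWithinAt_iff_isLittleO.mp (hd.hasDerivWithinAt (s := Set.Ici 0)))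
  refine Asymptotics.IsBigO.of_bound 1 ?_
  filter_upwards [self_mem_nhdsWithin] with s hs
  have := h s hs
  simp only [sub_zero, zero_mul, Real.exp_zero, smul_eq_mul, one_mul]
  exact this.trans (le_abs_self _)

/-! ### The evolution of a program -/

/-- The product `U n * ⋯ * U 1 * U 0`. -/
def partialProd (U : ℕ → SU4) : ℕ → SU4
  | 0 => U 0
  | n + 1 => U (n + 1) * partialProd U n

theorem coe_partialProd (U : ℕ → SU4) (n : ℕ) :
    (partialProd U n : Op) = orderedProd (fun j => (U j : Op)) n * (U 0 : Op) := by
  induction n with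
  | zero => simp [partialProd, orderedProd]
  | succ n ih => rw [partialProd, Submonoid.coe_mul, ih, orderedProd, mul_assoc]

theorem exp_Ad (g : SU4) (X : Op) : NormedSpace.exp (Ad g X) = Ad g (NormedSpace.exp X) := by
  have h : ((g⁻¹ : SU4) : Op) = (g : Op)⁻¹ :=
    (Matrix.inv_eq_left_inv (coe_inv_mul_self g)).symm
  rw [Ad_apply, Ad_apply, h, Matrix.exp_conj']
  exact IsUnit.of_mul_eq_one _ (coe_mul_inv_self g)

section Evolution

open scoped Matrix.Norms.Operator

/-- The norm is the maximal absolute row sum, and each of the four entries of a row has absolute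
value at most 1. -/
theorem norm_SU4_le (g : SU4) : ‖(g : Op)‖ ≤ 4 := by
  rw [Matrix.linfty_opNorm_def]
  have : (4 : ℝ) = ((4 : NNReal) : ℝ) := rfl
  rw [this, NNReal.coe_le_coe]
  refine Finset.sup_le fun i _ => ?_
  calc ∑ j, ‖(g : Op) i j‖₊ ≤ ∑ _j : Fin 2 × Fin 2, (1 : NNReal) :=
        Finset.sum_le_sum fun j _ =>
          entry_norm_bound_of_unitary (Matrix.mem_specialUnitaryGroup_iff.mp g.2).1 i j
    _ = 4 := by simp

theorem norm_Ad_le (g : SU4) (X : Op) : ‖Ad g X‖ ≤ 16 * ‖X‖ := by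
  rw [Ad_apply]
  calc _ ≤ ‖((g⁻¹ : SU4) : Op)‖ * ‖X‖ * ‖(g : Op)‖ :=
        (norm_mul_le _ _).trans (mul_le_mul_of_nonneg_right (norm_mul_le _ _) (norm_nonneg _))
    _ ≤ 4 * ‖X‖ * 4 := by
        gcongr
        · exact norm_SU4_le _
        · exact norm_SU4_le _
    _ = 16 * ‖X‖ := by ring

/-- The factor `U j * exp (-i s H τ j)` of a program. -/
def programFactor (H : Op) (U : ℕ → SU4) (τ : ℕ → ℝ) (s : ℝ) (j : ℕ) : Op :=
  (U j : Op) * NormedSpace.exp ((-I * (s : ℂ) * (τ j : ℂ)) • H)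

theorem smul_eq_real_smul (s r : ℝ) (H : Op) :
    (-I * (s : ℂ) * (r : ℂ)) • H = (s * r) • ((-I) • H) := by
  ext i j
  simp
  ring

/-- Removing the accumulated unitary W_n on the left makes each new factor an exponential of Ad(W_n)
applied to the scaled Hamiltonian. Time `τ (n + 1)` is paired with W_n because U_{n+1} acts after
that evolution. -/
theorem expApprox_program (H : Op) (U : ℕ → SU4) {τ : ℕ → ℝ} (hτ : ∀ j, 0 ≤ τ j) {s : ℝ}
    (hs : 0 ≤ s) (n : ℕ) :
    ExpApprox (((partialProd U n)⁻¹ : SU4) * (orderedProd (programFactor H U τ s) n * (U 0 : Op)))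
      (s • ∑ j ∈ Finset.range n, τ (j + 1) • Ad (partialProd U j) ((-I) • H))
      (s * ((∑ j ∈ Finset.range n, τ (j + 1)) * (16 * ‖(-I) • H‖))) := by
  induction n with
  | zero =>
    simp only [orderedProd, partialProd, one_mul, coe_inv_mul_self, Finset.range_zero,
      Finset.sum_empty, smul_zero, zero_mul, mul_zero]
    exact expApprox_one
  | succ n ih =>
    have hstep : (((partialProd U (n + 1))⁻¹ : SU4) : Op) *
        (orderedProd (programFactor H U τ s) (n + 1) * (U 0 : Op)) =
        NormedSpace.exp (Ad (partialProd U n) ((s * τ (n + 1)) • ((-I) • H))) *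
          (((partialProd U n)⁻¹ : SU4) *
            (orderedProd (programFactor H U τ s) n * (U 0 : Op))) := by
      rw [exp_Ad, Ad_apply, partialProd, mul_inv_rev, Submonoid.coe_mul, orderedProd,
        programFactor, smul_eq_real_smul]
      simp only [mul_assoc]
      rw [← mul_assoc (((U (n + 1))⁻¹ : SU4) : Op), coe_inv_mul_self, one_mul,
        ← mul_assoc ((partialProd U n : SU4) : Op), coe_mul_inv_self, one_mul]
    rw [hstep, Finset.sum_range_succ, Finset.sum_range_succ, smul_add, add_mul, mul_add]
    refine ExpApprox.mul ?_ ih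
    rw [smul_smul, ← map_smul]
    apply expApprox_exp
    refine (norm_Ad_le _ _).trans (le_of_eq ?_)
    rw [norm_smul, Real.norm_of_nonneg (mul_nonneg hs (hτ _))]
    ring

/-- The derivative at `0` of the evolution of a finite program. -/
theorem hasDerivWithinAt_finite_program (H : Op) (U : ℕ → SU4) {τ : ℕ → ℝ} (hτ : ∀ j, 0 ≤ τ j)
    {n : ℕ} (hU : partialProd U n = 1) :
    HasDerivWithinAt (fun s => orderedProd (programFactor H U τ s) n * (U 0 : Op))
      (∑ j ∈ Finset.range n, τ (j + 1) • Ad (partialProd U j) ((-I) • H)) (Set.Ici 0) 0 := by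
  refine hasDerivWithinAt_of_norm_le (A := 1)
    (k := (∑ j ∈ Finset.range n, τ (j + 1)) * (16 * ‖(-I) • H‖)) fun s hs => ?_
  have h := (expApprox_program H U hτ hs n).2.2
  rw [hU, inv_one, OneMemClass.coe_one, one_mul] at h
  exact h

/-- The derivative at `0` of the evolution of an infinite program. -/
theorem hasDerivWithinAt_infinite_program (H : Op) (U : ℕ → SU4) {τ : ℕ → ℝ}
    (hτ : ∀ j, 0 ≤ τ j) {t : ℝ} (ht : HasSum (fun j => τ (j + 1)) t)
    (hU : Tendsto (fun n => (partialProd U n : Op)) atTop (𝓝 1)) {Q : ℝ → Op}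
    (hQ : ∀ s, Tendsto (orderedProd (programFactor H U τ s)) atTop (𝓝 (Q s))) :
    ∃ D, HasSum (fun j => τ (j + 1) • Ad (partialProd U j) ((-I) • H)) D ∧
      HasDerivWithinAt (fun s => Q s * (U 0 : Op)) D (Set.Ici 0) 0 := by
  have hsum : Summable fun j => τ (j + 1) • Ad (partialProd U j) ((-I) • H) := by
    refine Summable.of_norm_bounded (ht.summable.mul_right (16 * ‖(-I) • H‖)) fun j => ?_
    rw [norm_smul, Real.norm_of_nonneg (hτ _)]
    exact mul_le_mul_of_nonneg_left (norm_Ad_le _ _) (hτ _)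
  refine ⟨_, hsum.hasSum, hasDerivWithinAt_of_norm_le (A := 1) (k := t * (16 * ‖(-I) • H‖))
    fun s hs => ?_⟩
  have hUinv : Tendsto (fun n => (((partialProd U n)⁻¹ : SU4) : Op)) atTop (𝓝 1) := by
    have := hU.star
    rwa [star_one] at this
  have h1 := hUinv.mul ((hQ s).mul_const (U 0 : Op))
  rw [one_mul] at h1
  have h2 := hsum.hasSum.tendsto_sum_nat.const_smul s
  have h3 := ((ht.tendsto_sum_nat.mul_const (16 * ‖(-I) • H‖)).const_mul s)
  refine le_of_tendsto_of_tendsto ((h1.sub_const 1).sub h2).norm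
    (((Real.continuous_exp.tendsto _).comp h3 |>.sub_const 1).sub h3) ?_
  exact Eventually.of_forall fun n => (expApprox_program H U hτ hs n).2.2

/-! ### Infinitesimal simulation and sums of conjugates -/

theorem hasDerivAt_exp_hamiltonian (H : Op) (s : ℝ) :
    HasDerivAt (fun s : ℝ => NormedSpace.exp ((-I * (s : ℂ)) • H))
      (NormedSpace.exp (s • ((-I) • H)) * ((-I) • H)) s := by
  have h : (fun s : ℝ => NormedSpace.exp ((-I * (s : ℂ)) • H)) =
      fun s : ℝ => NormedSpace.exp (s • ((-I) • H)) := by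
    funext s
    congr 1
    have := smul_eq_real_smul s 1 H
    simpa only [Complex.ofReal_one, mul_one] using this
  rw [h]
  exact hasDerivAt_exp_smul_const _ s

theorem tendsto_deriv_exp_hamiltonian (H : Op) :
    Tendsto (deriv fun s : ℝ => NormedSpace.exp ((-I * (s : ℂ)) • H)) (𝓝[>] 0)
      (𝓝 ((-I) • H)) := by
  have h : (deriv fun s : ℝ => NormedSpace.exp ((-I * (s : ℂ)) • H)) =
      fun s : ℝ => NormedSpace.exp (s • ((-I) • H)) * ((-I) • H) :=
    funext fun s => (hasDerivAt_exp_hamiltonian H s).deriv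
  have hc : Continuous fun s : ℝ => NormedSpace.exp (s • ((-I) • H)) * ((-I) • H) :=
    (continuous_iff_continuousAt.mpr fun s =>
      (hasDerivAt_exp_smul_const ((-I) • H : Op) s).continuousAt).mul continuous_const
  rw [h]
  have := (hc.tendsto 0).mono_left (nhdsWithin_le_nhds (s := Set.Ioi 0))
  simpa using this

/-- Simulation is defined by the limit of derivatives from the right, while the norm estimates give
the one-sided derivative at 0; by the mean value inequality the two agree. -/
theorem eq_of_tendsto_deriv {F : ℝ → Op} {D D' : Op}
    (hdiff : ∀ᶠ s in 𝓝[>] 0, DifferentiableAt ℝ F s)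
    (hD : Tendsto (deriv F) (𝓝[>] 0) (𝓝 D)) (hD' : HasDerivWithinAt F D' (Set.Ici 0) 0) :
    D = D' := by
  obtain ⟨u, hu, hsub⟩ := mem_nhdsGT_iff_exists_Ioo_subset.mp hdiff
  have h := hasDerivWithinAt_Ici_of_tendsto_deriv (s := Set.Ioo 0 u)
    (fun s hs => (hsub hs).differentiableWithinAt)
    (hD'.continuousWithinAt.mono fun s hs => hs.1.le) (Ioo_mem_nhdsGT hu) hD
  exact (uniqueDiffOn_Ici (0 : ℝ) 0 Set.self_mem_Ici).eq_deriv _ h hD'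

theorem hasSum_neg_iff_smul {c : ℕ → ℝ} {V : ℕ → SU4} {H H' : Op}
    (h : HasSum (fun j => c j • Ad (V j) ((-I) • H)) ((-I) • H')) :
    HasSum (fun j => c j • Ad (V j) (I • H)) (I • H') := by
  have := h.neg
  simpa only [neg_smul, map_neg, smul_neg, neg_neg] using this

theorem exists_hasSum_of_simulates {H H' : Op} {t : ℝ} (h : SimulatesInfinitesimally H H' t) :
    ∃ (c : ℕ → ℝ) (V : ℕ → SU4), (∀ j, 0 ≤ c j) ∧ HasSum c t ∧
      HasSum (fun j => c j • Ad (V j) (I • H)) (I • H') := by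
  obtain ⟨m, U, τ, -, hτ, ht, ⟨P, hP, hPU⟩, Q, hQ, hdiff, D, hD, hD'⟩ := h
  obtain rfl := tendsto_nhds_unique hD (tendsto_deriv_exp_hamiltonian H')
  match m with
  | some n =>
    have hU : partialProd U n = 1 := by
      apply Subtype.ext
      rw [coe_partialProd]
      rw [show P = _ from hP] at hPU
      exact hPU
    have hF := hasDerivWithinAt_finite_program H U hτ hU
    have hQ' : Q = fun s => orderedProd (programFactor H U τ s) n := funext hQ
    rw [hQ'] at hdiff hD'
    have heq := eq_of_tendsto_deriv hdiff hD' hF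
    -- A finite program becomes a series by padding its times with zeros.
    refine ⟨fun j => if j < n then τ (j + 1) else 0, partialProd U, fun j => ?_, ?_,
      hasSum_neg_iff_smul ?_⟩
    · dsimp only
      split_ifs
      exacts [hτ _, le_rfl]
    · have ht' : t = ∑ j ∈ Finset.range n, τ (j + 1) := by
        rw [show t = _ from ht, Finset.range_eq_Ico, Finset.sum_Ico_add' τ 0 n 1]
        rfl
      rw [ht']
      have : ∑ j ∈ Finset.range n, τ (j + 1) =
          ∑ j ∈ Finset.range n, (if j < n then τ (j + 1) else 0) :=
        Finset.sum_congr rfl fun j hj => (if_pos (Finset.mem_range.mp hj)).symm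
      rw [this]
      exact hasSum_sum_of_ne_finset_zero fun j hj => if_neg (by simpa using hj)
    · rw [heq]
      have : ∑ j ∈ Finset.range n, τ (j + 1) • Ad (partialProd U j) ((-I) • H) =
          ∑ j ∈ Finset.range n, (if j < n then τ (j + 1) else 0) •
            Ad (partialProd U j) ((-I) • H) :=
        Finset.sum_congr rfl fun j hj => by rw [if_pos (Finset.mem_range.mp hj)]
      rw [this]
      exact hasSum_sum_of_ne_finset_zero fun j hj => by
        rw [if_neg (by simpa using hj), zero_smul]
  | none =>
    have hU : Tendsto (fun n => (partialProd U n : Op)) atTop (𝓝 1) := by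
      have h1 : Tendsto (orderedProd fun j => (U j : Op)) atTop (𝓝 P) := hP
      have h2 := h1.mul_const (U 0 : Op)
      rw [hPU] at h2
      simpa only [coe_partialProd] using h2
    obtain ⟨D', hsum, hF⟩ := hasDerivWithinAt_infinite_program H U hτ ht hU hQ
    have heq := eq_of_tendsto_deriv hdiff hD' hF
    refine ⟨fun j => τ (j + 1), partialProd U, fun j => hτ _, ht, hasSum_neg_iff_smul ?_⟩
    rw [heq]
    exact hsum

theorem contDiff_orderedProd (H : Op) (U : ℕ → SU4) (τ : ℕ → ℝ) (n : ℕ) :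
    ContDiff ℝ 1 fun s => orderedProd (programFactor H U τ s) n * (U 0 : Op) := by
  refine ContDiff.mul ?_ contDiff_const
  induction n with
  | zero => exact contDiff_const
  | succ n ih =>
    simp only [orderedProd]
    refine ContDiff.mul (contDiff_const.mul ?_) ih
    set Y : Op := τ (n + 1) • ((-I) • H) with hY
    have hYs : (fun s : ℝ => NormedSpace.exp ((-I * (s : ℂ) * (τ (n + 1) : ℂ)) • H)) =
        fun s => NormedSpace.exp (s • Y) := by
      funext s
      rw [smul_eq_real_smul, hY, smul_smul]
    rw [hYs]
    have hd := fun s : ℝ => hasDerivAt_exp_smul_const Y s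
    rw [contDiff_one_iff_deriv]
    refine ⟨fun s => (hd s).differentiableAt, ?_⟩
    exact ((continuous_iff_continuousAt.mpr fun s => (hd s).continuousAt).mul
      continuous_const).congr fun s => (hd s).deriv.symm

theorem simulates_of_sum {H H' : Op} {n : ℕ} {τ : ℕ → ℝ} (hτ : ∀ j, 0 ≤ τ j) {V : ℕ → SU4}
    (hV : ∀ j, IsLocalUnitary (V j))
    (h : ∑ j ∈ Finset.range n, τ j • Ad (V j) (I • H) = I • H') :
    SimulatesInfinitesimally H H' (∑ j ∈ Finset.range n, τ j) := by
  set V' : ℕ → SU4 := fun j => if j < n then V j else 1 with hV'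
  have hV'loc : ∀ j, V' j ∈ groupK := fun j => by
    rw [hV']
    dsimp only
    split_ifs
    exacts [isLocalUnitary_iff_mem_groupK.mp (hV j), one_mem _]
  -- The factors telescope, so the partial products are exactly the `V' j`; as `V' n = 1`, the whole
  -- product is the identity.
  set U : ℕ → SU4 := fun j => Nat.casesOn j (V' 0) fun j => V' (j + 1) * (V' j)⁻¹ with hU
  -- Program times are numbered from 1; the value `σ 0` never enters.
  set σ : ℕ → ℝ := fun j => τ (j - 1) with hσ
  have hσ0 : ∀ j, 0 ≤ σ j := fun j => hτ _
  have hpart : ∀ j, partialProd U j = V' j := by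
    intro j
    induction j with
    | zero => rfl
    | succ j ih =>
      rw [partialProd, ih]
      change V' (j + 1) * (V' j)⁻¹ * V' j = _
      rw [inv_mul_cancel_right]
  have hn : partialProd U n = 1 := by
    rw [hpart, hV']
    simp
  have hF := hasDerivWithinAt_finite_program H U hσ0 hn
  have hc := contDiff_orderedProd H U σ n
  have hsum : ∑ j ∈ Finset.range n, σ (j + 1) • Ad (partialProd U j) ((-I) • H) = (-I) • H' := by
    rw [neg_smul, neg_smul, ← h, ← Finset.sum_neg_distrib]
    refine Finset.sum_congr rfl fun j hj => ?_
    rw [hpart, map_neg, smul_neg, hV']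
    simp only [if_pos (Finset.mem_range.mp hj)]
    rfl
  refine ⟨(n : ℕ∞), U, σ, fun j => ?_, hσ0, ?_, ⟨_, rfl, ?_⟩,
    fun s => orderedProd (programFactor H U σ s) n, fun s => rfl,
    Eventually.of_forall fun s => (hc.differentiable one_ne_zero) s, (-I) • H',
    tendsto_deriv_exp_hamiltonian H', ?_⟩
  · rw [isLocalUnitary_iff_mem_groupK]
    cases j with
    | zero => exact hV'loc 0
    | succ j => exact mul_mem (hV'loc _) (inv_mem (hV'loc _))
  · change _ = ∑ j ∈ Finset.Icc 1 n, τ (j - 1)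
    have : Finset.Icc 1 n = Finset.Ico (0 + 1) (n + 1) := rfl
    rw [this, ← Finset.sum_Ico_add' (fun j => τ (j - 1)) 0 n 1, Finset.range_eq_Ico]
    rfl
  · rw [← coe_partialProd, hn]
    rfl
  · have hcont := hc.continuous_deriv le_rfl
    -- The evolution of a finite program is C¹ on the whole line, so the limit of its derivatives is
    -- the derivative at 0, which equals the right derivative found above.
    have h0 : deriv (fun s => orderedProd (programFactor H U σ s) n * (U 0 : Op)) 0 =
        (-I) • H' := by
      rw [← hsum]
      exact (uniqueDiffOn_Ici (0 : ℝ) 0 Set.self_mem_Ici).eq_deriv _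
        ((hc.differentiable one_ne_zero) 0).hasDerivAt.hasDerivWithinAt hF
    exact (hcont.tendsto' 0 _ h0).mono_left nhdsWithin_le_nhds

end Evolution

/-! ### Convex combinations of the Weyl orbit and the simulation criterion -/

theorem exists_Ad_of_mem_weylOrbit {p x : Op} (hx : x ∈ weylOrbit p) :
    ∃ g ∈ groupK, x = Ad g p := by
  obtain ⟨a, ⟨k, hk, ha⟩, w, rfl⟩ := hx
  obtain ⟨g, rfl⟩ := QuotientGroup.mk_surjective w
  exact ⟨k * g, mul_mem hk g.2.1, by rw [weylAct_mk, Ad_mul, ha]⟩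

theorem exists_sum_of_mem_convexHull {p x : Op} {t : ℝ} (ht : 0 < t)
    (hx : t⁻¹ • x ∈ convexHull ℝ (weylOrbit p)) :
    ∃ (n : ℕ) (τ : ℕ → ℝ) (V : ℕ → SU4), (∀ j, 0 ≤ τ j) ∧ (∀ j, V j ∈ groupK) ∧
      ∑ j ∈ Finset.range n, τ j = t ∧ ∑ j ∈ Finset.range n, τ j • Ad (V j) p = x := by
  obtain ⟨ι, _, w, z, hw0, hw1, hz, hsum⟩ := mem_convexHull_iff_exists_fintype.mp hx
  choose g hg hgz using fun i => exists_Ad_of_mem_weylOrbit (hz i)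
  let e := Fintype.equivFin ι
  have hsum' : ∑ i, (t * w i) • Ad (g i) p = x := by
    simp only [mul_smul, ← Finset.smul_sum, ← hgz, hsum]
    rw [smul_smul, mul_inv_cancel₀ ht.ne', one_smul]
  -- The weights are rescaled by t; outside the index range, time 0 and the identity are dummy
  -- values.
  refine ⟨Fintype.card ι, fun j => if h : j < Fintype.card ι then t * w (e.symm ⟨j, h⟩) else 0,
    fun j => if h : j < Fintype.card ι then g (e.symm ⟨j, h⟩) else 1, fun j => ?_, fun j => ?_,
    ?_, ?_⟩
  · dsimp only
    split_ifs
    exacts [mul_nonneg ht.le (hw0 _), le_rfl]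
  · dsimp only
    split_ifs
    exacts [hg _, one_mem _]
  · rw [Finset.sum_range]
    simp only [Fin.is_lt, dite_true, Fin.eta]
    rw [e.symm.sum_comp fun i => t * w i, ← Finset.mul_sum, hw1, mul_one]
  · rw [Finset.sum_range]
    simp only [Fin.is_lt, dite_true, Fin.eta]
    rw [e.symm.sum_comp fun i => (t * w i) • Ad (g i) p, hsum']

theorem simulates_iff {H H' : Op} (hH : IsNonlocalHamiltonian H) {t : ℝ} (ht : 0 < t) {a' : Op}
    (ha' : a' ∈ aSpace) {L : SU4} (hL : IsLocalUnitary L) (hconj : a' = Ad L (I • H')) :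
    SimulatesInfinitesimally H H' t ↔ t⁻¹ • a' ∈ convexHull ℝ (weylOrbit (I • H)) := by
  constructor
  · intro h
    obtain ⟨k, hk, hkp⟩ := exists_Ad_mem_aSpace hH
    obtain ⟨c, V, hc, hct, hsum⟩ := exists_hasSum_of_simulates h
    -- Ad reverses products, so a factor L on the right of each V_j carries the decomposition of iH'
    -- to one of a'; the converse uses L⁻¹.
    refine smul_mem_convexHull_of_hasSum hk hkp ha' ht hc hct (V := fun j => V j * L) ?_
    have hcont : Continuous (Ad L) :=
      (continuous_const.mul continuous_id).mul continuous_const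
    have := hsum.map (Ad L) hcont
    rw [← hconj] at this
    simpa only [Function.comp_def, map_smul, Ad_mul] using this
  · intro h
    obtain ⟨n, τ, V, hτ, hV, hτt, hsum⟩ := exists_sum_of_mem_convexHull ht h
    rw [← hτt]
    refine simulates_of_sum hτ (V := fun j => V j * L⁻¹) (fun j => ?_) ?_
    · rw [isLocalUnitary_iff_mem_groupK] at hL ⊢
      exact mul_mem (hV j) (inv_mem hL)
    · have := congrArg (Ad L⁻¹) hsum
      rw [hconj, Ad_inv_Ad, map_sum] at this
      simpa only [map_smul, Ad_mul] using this

end TwoQubit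

end

/-- Two-qubit infinitesimal Hamiltonian simulation: the criterion holds for every local conjugate
`a' ∈ 𝔞` of `i H'`, and it does not depend on the choice of `a'`. -/
theorem mainTheorem3 (H H' : TwoQubit.Op)
    (hH : TwoQubit.IsNonlocalHamiltonian H) (hH' : TwoQubit.IsNonlocalHamiltonian H')
    (t : ℝ) (ht : 0 < t)
    (a' : TwoQubit.Op) (ha' : a' ∈ TwoQubit.aSpace)
    (L' : TwoQubit.SU4) (hL' : TwoQubit.IsLocalUnitary L')
    (hconj : a' = TwoQubit.Ad L' (Complex.I • H')) :
    (TwoQubit.SimulatesInfinitesimally H H' t ↔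
      t⁻¹ • a' ∈ convexHull ℝ (TwoQubit.weylOrbit (Complex.I • H))) ∧
    (∀ a'' ∈ TwoQubit.aSpace, ∀ L'' : TwoQubit.SU4, TwoQubit.IsLocalUnitary L'' →
      a'' = TwoQubit.Ad L'' (Complex.I • H') →
      (t⁻¹ • a' ∈ convexHull ℝ (TwoQubit.weylOrbit (Complex.I • H)) ↔
        t⁻¹ • a'' ∈ convexHull ℝ (TwoQubit.weylOrbit (Complex.I • H)))) := by
  -- Simulability does not involve the chosen conjugate, so the criteria for a' and a'' are
  -- equivalent through it.
  have key := fun (a : TwoQubit.Op) (ha : a ∈ TwoQubit.aSpace) (L : TwoQubit.SU4)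
    (hL : TwoQubit.IsLocalUnitary L) (h : a = TwoQubit.Ad L (Complex.I • H')) =>
    TwoQubit.simulates_iff hH ht ha hL h
  exact ⟨key a' ha' L' hL' hconj, fun a'' ha'' L'' hL'' h =>
    (key a' ha' L' hL' hconj).symm.trans (key a'' ha'' L'' hL'' h)⟩
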